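/- **Setting.** For integers $M,B\ge 0$ the floating-point format $(M,B)$ consists of $0$ and of the numbers $(-1)^{s_a}\cdot 1.a\cdot 2^{(-1)^{s_b}b}$ with sign bits $s_a,s_b$, an $M$-bit fraction $a$ and a $B$-bit integer $b$; it has $1+M+1+B$ bits of precision. Every sum, product and quotient of numbers of the format is computed exactly and then rounded to the nearest number of the format (ties towards $0$; numbers beyond the largest one go to the largest one). Sums of several numbers are evaluated from left to right. A one-layer, one-head softmax Transformer on $N$ tokens with value dimension $1$ consists of a position-dependent embedding of tokens in $\mathbb R^d$, matrices $W^Q,W^K\in\mathbb R^{d\times d_q}$, $W^V\in\mathbb R^{d\times 1}$ and an MLP $\mathbb R\to\mathbb R^d$ with one hidden layer and ReLU activations on the hidden and output nodes ($d\ge 1$, $d_q$ and the hidden width are arbitrary). With embedded tokens $X_1,\dots,X_N$ its $i$-th output is the MLP applied to $$\frac{\sum_j e^{s_{ij}}X_jW^V}{\sum_j e^{s_{ij}}},\qquad s_{ij}=\langle X_iW^Q,X_jW^K\rangle .$$ The exponentials are rounded to the format, and everything after them (each summand $(e^{s_{ij}}X_j)W^V$, both sums over $j$, the quotient, the MLP)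 is computed in the format, with the parameters rounded to it. The scores $s_{ij}$ are computed either exactly or in another arithmetic, as specified below. Let $p\ge 6$, $m=2p-1$ (so $p=\lceil m/2\rceil$), $L=\lceil\log_2 p\rceil$ and $n>4p$. Call integers $(t,e)$ admissible if $t+e=p+L$, $e>L+2$ and $t>2$. For $\mathbf y,\mathbf z\in\{0,1\}^m$, with bits of index larger than $m$ read as $0$, put $$u^1_{\mathbf y}=(y_1,\dots,y_{e-1}),\qquad u^2_{\mathbf y}=(y_{t+e-1},\dots,y_{t+2e-2-L}),$$ the latter filled up with zeros to length $e-1$. The input representation $\mathcal T^3_m(\mathbf y,\mathbf z)$ with parameters $(t,e)$ is the sequence of $n$ tokens in $\{0,1\}^{e-1}\times\{0,1\}$, indexed by $0,\dots,n-1$, whose tokens at indices $0,\dots,m-1$ are * index $0$: $(u^1_{\mathbf y},0)$; index $i$ for $1\le i\le t-1$: $(u^1_{\mathbf y},y_{e+i-1})$; * index $t-1+i$ for $1\le i\le t-1$: $(u^2_{\mathbf y},y_{t+2e-2-L+i})$; index $2t-1$: $(u^2_{\mathbf y},0)$; indices $2t,\dots,m-1$: zero; and the others are * index $m$: $(u^1_{\mathbf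 z},0)$; index $m+i$ for $1\le i\le t-1$: $(u^1_{\mathbf z},z_{e+i-1})$; * index $m+t-1+i$ for $1\le i\le t-1$: $(u^2_{\mathbf z},z_{t+2e-2-L+i})$; indices $m+2t-1,\dots,2m$: zero; index $2m+1$: $(u^2_{\mathbf z},0)$; all later indices: zero. A Transformer on $n+1$ tokens computes $\mathsf{EQ}_m$ in this representation if, on $\mathcal T^3_m(\mathbf y,\mathbf z)$ followed by a zero token, the first entry of its last output is $1$ when $\mathbf y=\mathbf z$ and $0$ when $\mathbf y\ne\mathbf z$, for all $\mathbf y,\mathbf z\in\{0,1\}^m$ such that $\mathbf y\le\mathbf z$ as binary numbers and $z_1\cdots z_e\ne 1\cdots 1$. **Theorem.** Let $p\ge 6$, $n>4p$ and $m=2p-1$. Admissible pairs $(t,e)$ exist, and for every admissible pair $(t,e)$, with the input representation $\mathcal T^3_m$ with parameters $(t,e)$: 1. No one-layer, one-head softmax Transformer with value dimension $1$ computes $\mathsf{EQ}_m$ in a floating-point format of at most $p-1$ bits, whether its scores are computed exactly, in the format, or in an arithmetic with any other rounding map. 2. There is a one-layer, one-head softmax Transformer with value dimension $1$ that computes $\mathsf{EQ}_m$,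 with exactly computed scores, in the format $(M,B)=(t-1,e-1)$, which has $p+\lceil\log_2 p\rceil$ bits (the sign bits being counted in $t$ and $e$); and there is one that does so in the format $(M,B)=(t,e)$, which has $p+\lceil\log_2 p\rceil+2$ bits (the sign bits being counted in addition). -/

import Mathlib

namespace FPTransformer

/-- A floating-point format: `M` bits `a` of mantissa (the mantissa is `1.a`) and `B` bits `b` of
exponent, each with one additional sign bit. -/
structure Format where
  M : ℕ
  B : ℕ

namespace Format

/-- The number of bits of precision, `1 + |a| + 1 + |b|`. -/
def bits (F : Format) : ℕ := 1 + F.M + 1 + F.B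

/-- The value `(-1)^{s_a} * 1.a * 2^{(-1)^{s_b} * b}`. -/
noncomputable def value (F : Format) (sa : Bool) (a : Fin (2 ^ F.M)) (sb : Bool)
    (b : Fin (2 ^ F.B)) : ℝ :=
  (if sa then -1 else 1) * (1 + (a : ℝ) / 2 ^ F.M) *
    (2 : ℝ) ^ (if sb then -((b : ℕ) : ℤ) else ((b : ℕ) : ℤ))

/-- The permissible numbers of the format: the values of the quadruples, and zero. -/
def permissible (F : Format) : Set ℝ :=
  insert 0 {x | ∃ sa a sb b, x = F.value sa a sb b}

/-- `r` is the permissible number nearest to `x`; a tie is broken by truncation, i.e. in favour of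
the number of smaller absolute value. -/
def IsRounding (F : Format) (x r : ℝ) : Prop :=
  r ∈ F.permissible ∧
    ∀ s ∈ F.permissible, |x - r| < |x - s| ∨ (|x - r| = |x - s| ∧ |r| ≤ |s|)

theorem permissible_finite (F : Format) : F.permissible.Finite := by
  refine Set.Finite.insert 0 ?_
  refine (Set.finite_range
    (fun q : Bool × Fin (2 ^ F.M) × Bool × Fin (2 ^ F.B) =>
      F.value q.1 q.2.1 q.2.2.1 q.2.2.2)).subset ?_
  rintro x ⟨sa, a, sb, b, rfl⟩
  exact ⟨(sa, a, sb, b), rfl⟩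

theorem exists_isRounding (F : Format) (x : ℝ) : ∃ r, F.IsRounding x r := by
  obtain ⟨r, hr, hmin⟩ := Set.exists_min_image F.permissible
    (fun s => toLex (|x - s|, |s|)) F.permissible_finite ⟨0, Set.mem_insert _ _⟩
  refine ⟨r, hr, fun s hs => ?_⟩
  simpa [Prod.Lex.le_iff] using hmin s hs

theorem isRounding_unique (F : Format) {x r s : ℝ} (hr : F.IsRounding x r)
    (hs : F.IsRounding x s) : r = s := by
  have h1 := hr.2 s hs.1
  have h2 := hs.2 r hr.1
  have hd : |x - r| = |x - s| := by
    rcases h1 with h | h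
    · rcases h2 with h' | h'
      · linarith
      · linarith [h'.1]
    · exact h.1
  have ha : |r| = |s| := by
    rcases h1 with h | h
    · linarith
    · rcases h2 with h' | h'
      · linarith
      · exact le_antisymm h.2 h'.2
  rcases abs_eq_abs.mp ha with h | h
  · exact h
  · rcases abs_eq_abs.mp hd with h' | h'
    · linarith
    · have hx : x = 0 := by linarith
      have h0 := hr.2 0 (Set.mem_insert _ _)
      rw [hx] at h0
      have hr0 : |r| = 0 := by
        have := abs_nonneg r
        simp only [zero_sub, abs_neg, neg_zero, abs_zero] at h0
        rcases h0 with h0 | h0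
        · linarith
        · exact h0.1
      have := abs_eq_zero.mp hr0
      linarith

/-- Rounding to the format. -/
noncomputable def round (F : Format) (x : ℝ) : ℝ := (F.exists_isRounding x).choose

theorem round_spec (F : Format) (x : ℝ) : F.IsRounding x (F.round x) :=
  (F.exists_isRounding x).choose_spec

end Format

/-! Arithmetic relative to a rounding map `ρ`: the operands are stored in the format, the exact
result is computed, and then rounded. The choice `ρ = id` is exact arithmetic. -/

/-- Multiplication of two numbers. -/
def mul (ρ : ℝ → ℝ) (x y : ℝ) : ℝ := ρ (ρ x * ρ y)

/-- Addition of two numbers. -/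
def add (ρ : ℝ → ℝ) (x y : ℝ) : ℝ := ρ (ρ x + ρ y)

/-- The left-associative sum `((x₁ + x₂) + x₃) + ⋯ + xₖ`. -/
def lsum (ρ : ℝ → ℝ) {k : ℕ} (x : Fin k → ℝ) : ℝ := (List.ofFn x).foldl (add ρ) 0

/-- The inner product, with a left-associative sum. -/
def dot (ρ : ℝ → ℝ) {k : ℕ} (u v : Fin k → ℝ) : ℝ := lsum ρ fun a => mul ρ (u a) (v a)

/-- The parameters of a one-layer, one-head softmax Transformer on `N` tokens over the alphabet
`A`, with embedding dimension `d`, query dimension `dq`, value dimension `dv` and `dff` hidden nodes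
in the MLP. The embedding may depend on the position of the token. -/
structure Transformer (N : ℕ) (A : Type) (d dq dv dff : ℕ) where
  embed : Fin N → A → Fin d → ℝ
  WQ : Fin d → Fin dq → ℝ
  WK : Fin d → Fin dq → ℝ
  WV : Fin d → Fin dv → ℝ
  w1 : Fin dv → Fin dff → ℝ
  b1 : Fin dff → ℝ
  w2 : Fin dff → Fin d → ℝ
  b2 : Fin d → ℝ

namespace Transformer

variable {N : ℕ} {A : Type} {d dq dv dff : ℕ}

/-- The score `⟨Q_i, K_j⟩` with `Q = X W^Q` and `K = X W^K`; `σ` is the rounding map of the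
arithmetic in which the scores are computed. -/
def score (T : Transformer N A d dq dv dff) (σ : ℝ → ℝ) (x : Fin N → A) (i j : Fin N) : ℝ :=
  dot σ (fun k => dot σ (T.embed i (x i)) fun a => T.WQ a k)
    (fun k => dot σ (T.embed j (x j)) fun a => T.WK a k)

/-- The attention weight `e^{⟨Q_i, K_j⟩}` in the format `F`. -/
noncomputable def weight (T : Transformer N A d dq dv dff) (F : Format) (σ : ℝ → ℝ)
    (x : Fin N → A) (i j : Fin N) : ℝ :=
  F.round (Real.exp (T.score σ x i j))

/-- The numerator `∑_j e^{⟨Q_i, K_j⟩} X_j W^V`: each summand is multiplied from left to right, and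
the summands are added from left to right. -/
noncomputable def numerator (T : Transformer N A d dq dv dff) (F : Format) (σ : ℝ → ℝ)
    (x : Fin N → A) (i : Fin N) (c : Fin dv) : ℝ :=
  lsum F.round fun j =>
    dot F.round (fun a => mul F.round (T.weight F σ x i j) (T.embed j (x j) a)) fun a => T.WV a c

/-- The denominator `∑_j e^{⟨Q_i, K_j⟩}`. -/
noncomputable def denominator (T : Transformer N A d dq dv dff) (F : Format) (σ : ℝ → ℝ)
    (x : Fin N → A) (i : Fin N) : ℝ :=
  lsum F.round fun j => T.weight F σ x i j

/-- Softmax self-attention in the format `F`. -/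
noncomputable def attention (T : Transformer N A d dq dv dff) (F : Format) (σ : ℝ → ℝ)
    (x : Fin N → A) (i : Fin N) (c : Fin dv) : ℝ :=
  F.round (T.numerator F σ x i c / T.denominator F σ x i)

/-- The MLP layer with one hidden layer and ReLU activations, in the format `F`. -/
noncomputable def mlp (T : Transformer N A d dq dv dff) (F : Format) (v : Fin dv → ℝ) :
    Fin d → ℝ :=
  fun k => max 0 (add F.round
    (dot F.round
      (fun j => max 0 (add F.round (dot F.round v fun c => T.w1 c j) (T.b1 j)))
      (fun j => T.w2 j k))
    (T.b2 k))

/-- The `i`-th output row. -/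
noncomputable def output (T : Transformer N A d dq dv dff) (F : Format) (σ : ℝ → ℝ)
    (x : Fin N → A) (i : Fin N) : Fin d → ℝ :=
  T.mlp F (T.attention F σ x i)

end Transformer

/-- The number whose binary expression is `y₁ y₂ … y_m` (here `y i` is the bit `y_{i+1}`). -/
def binVal {m : ℕ} (y : Fin m → Bool) : ℕ :=
  ∑ i : Fin m, if y i then 2 ^ (m - 1 - (i : ℕ)) else 0

/-- The bit `y_i` for `1 ≤ i ≤ m`, and `0` for an index outside of this range. -/
def bit {m : ℕ} (y : Fin m → Bool) (i : ℕ) : Bool :=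
  if h : 1 ≤ i ∧ i ≤ m then y ⟨i - 1, by omega⟩ else false

/-- A token: a tuple of `e - 1` bits, and one more bit. -/
abbrev Token (e : ℕ) : Type := (Fin (e - 1) → Bool) × Bool

/-- The token that consists of zeros; it is also the placeholder in the last position. -/
def zeroToken (e : ℕ) : Token e := (fun _ => false, false)

/-- `log ⌈m/2⌉`, rounded up to an integer. -/
def lg (m : ℕ) : ℕ := Nat.clog 2 ((m + 1) / 2)

/-- The tuple `(y_1, …, y_{e-1})`. -/
def tuple₁ {m : ℕ} (e : ℕ) (y : Fin m → Bool) : Fin (e - 1) → Bool := fun k => bit y (k + 1)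

/-- The tuple `(y_{t+e-1}, …, y_{t+2e-2-log ⌈m/2⌉})` of `e - log ⌈m/2⌉` bits, filled up with zeros
to the length `e - 1`. -/
def tuple₂ {m : ℕ} (t e : ℕ) (y : Fin m → Bool) : Fin (e - 1) → Bool :=
  fun k => if (k : ℕ) < e - lg m then bit y (t + e - 1 + k) else false

/-- The input representation, with tokens indexed from `0` to `n - 1`. -/
def inputRep {m : ℕ} (n t e : ℕ) (y z : Fin m → Bool) (i : Fin n) : Token e :=
  if (i : ℕ) = 0 then (tuple₁ e y, false)
  else if (i : ℕ) ≤ t - 1 then (tuple₁ e y, bit y (e + i - 1))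
  else if (i : ℕ) ≤ 2 * t - 2 then
    (tuple₂ t e y, bit y (t + 2 * e - 2 - lg m + (i - (t - 1))))
  else if (i : ℕ) = 2 * t - 1 then (tuple₂ t e y, false)
  else if (i : ℕ) ≤ m - 1 then zeroToken e
  else if (i : ℕ) = m then (tuple₁ e z, false)
  else if (i : ℕ) ≤ m + (t - 1) then (tuple₁ e z, bit z (e + (i - m) - 1))
  else if (i : ℕ) ≤ m + (2 * t - 2) then
    (tuple₂ t e z, bit z (t + 2 * e - 2 - lg m + (i - (m + (t - 1)))))
  else if (i : ℕ) ≤ 2 * m then zeroToken e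
  else if (i : ℕ) = 2 * m + 1 then (tuple₂ t e z, false)
  else zeroToken e

/-- The promise on the inputs: `y ≤ z` as binary numbers, and `z_1 … z_e` is not `1 … 1`. -/
def Promise {m : ℕ} (e : ℕ) (y z : Fin m → Bool) : Prop :=
  binVal y ≤ binVal z ∧ ∃ i, 1 ≤ i ∧ i ≤ e ∧ bit z i = false

/-- The Transformer on `n + 1` tokens, with the format `F` and with scores computed in the arithmetic
of `σ`, computes equality of `m`-bit strings in the input representation with parameters `(t, e)`:
on the `n` tokens of the representation followed by the placeholder, the first entry of the last
output row is `1` if `y = z` and `0` otherwise, for all inputs that satisfy the promise. -/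
def ComputesEQ (m n t e : ℕ) {d dq dv dff : ℕ} (hd : 0 < d)
    (T : Transformer (n + 1) (Token e) d dq dv dff) (F : Format) (σ : ℝ → ℝ) : Prop :=
  ∀ y z : Fin m → Bool, Promise e y z →
    T.output F σ (Fin.snoc (inputRep n t e y z) (zeroToken e)) (Fin.last n) ⟨0, hd⟩ =
      if y = z then 1 else 0

/-- The conditions on the parameters `(t, e)` for strings of length `m`. -/
def Admissible (m t e : ℕ) : Prop :=
  t + e = (m + 1) / 2 + lg m ∧ lg m + 2 < e ∧ 2 < t

end FPTransformer

/-! Lower bound: every score is taken against the last token, which is a fixed placeholder, so a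
token of `y` acts on the output only through the two accumulators (numerator and denominator)
reached after the first `m` tokens. A format of at most `p - 1` bits has fewer than `2 ^ (p - 1)`
numbers, hence fewer than `2 ^ (2 * p - 2)` such pairs, and there are that many strings starting
with `0`. Two of them collide; completing both with the larger one gives the same output on an equal
and on an unequal pair (`not_computesEQ`).

Upper bound: a string is cut into two halves, each read as a floating-point number `2 ^ κ * 1.f`.
The weights make the denominator the lower half of `y`: all other weights are so small that rounding
absorbs them (`run_denominator`). The values make the numerator minus the upper half of `y`, plus
the upper half of `z`, plus `2 ^ γ` times the lower half of `z`. If the upper halves agree they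
cancel exactly, and the quotient is `2 ^ γ` precisely when the lower halves agree; otherwise it
misses `2 ^ γ` by a relative error of at least `2 ^ (-M)` (`mant_gap`). If the upper halves differ,
`y ≤ z` makes their difference positive, and `γ` is so negative that even the least difference
pushes the quotient far above `2 ^ γ` (`NumeratorTerms.le_run`). A ReLU network detects the value `2
^ γ` with that tolerance.

No error estimate is needed: each sum is exact, or absorbs a term entirely, or is controlled by the
monotonicity of rounding at permissible bounds (`le_round`, `round_le`). -/

namespace FPTransformer

/-! ### Rounding and the permissible numbers. -/

namespace Format

/-- The largest exponent of the format. -/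
def emax (F : Format) : ℤ := 2 ^ F.B - 1

theorem emax_nonneg (F : Format) : 0 ≤ F.emax := by
  have : (1 : ℤ) ≤ 2 ^ F.B := one_le_pow₀ (by norm_num)
  unfold emax; omega

theorem zero_mem (F : Format) : (0 : ℝ) ∈ F.permissible := Set.mem_insert _ _

theorem round_mem (F : Format) (x : ℝ) : F.round x ∈ F.permissible := (F.round_spec x).1

theorem round_eq_self (F : Format) {x : ℝ} (hx : x ∈ F.permissible) : F.round x = x := by
  have h := (F.round_spec x).2 x hx
  have h0 : |x - F.round x| = 0 := by
    have := abs_nonneg (x - F.round x)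
    simp only [sub_self, abs_zero] at h
    rcases h with h | h
    · linarith
    · exact h.1
  have := abs_eq_zero.mp h0
  linarith

theorem abs_sub_round_le (F : Format) (x : ℝ) {s : ℝ} (hs : s ∈ F.permissible) :
    |x - F.round x| ≤ |x - s| := by
  rcases (F.round_spec x).2 s hs with h | h
  · exact h.le
  · exact h.1.le

/-- A permissible lower bound lying strictly above the rounded value would be nearer to `x`.
Inequalities against permissible thresholds thus survive any rounding, including saturation at the
largest number. -/
theorem le_round (F : Format) {a x : ℝ} (ha : a ∈ F.permissible) (h : a ≤ x) :
    a ≤ F.round x := by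
  by_contra! hlt
  have := F.abs_sub_round_le x ha
  rw [abs_of_nonneg (by linarith), abs_of_nonneg (by linarith)] at this
  linarith

theorem round_le (F : Format) {a x : ℝ} (ha : a ∈ F.permissible) (h : x ≤ a) :
    F.round x ≤ a := by
  by_contra! hlt
  have := F.abs_sub_round_le x ha
  rw [abs_of_nonpos (by linarith), abs_of_nonpos (by linarith)] at this
  linarith

theorem round_nonneg (F : Format) {x : ℝ} (h : 0 ≤ x) : 0 ≤ F.round x := F.le_round F.zero_mem h

theorem round_nonpos (F : Format) {x : ℝ} (h : x ≤ 0) : F.round x ≤ 0 := F.round_le F.zero_mem h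

@[simp]
theorem round_zero (F : Format) : F.round 0 = 0 := F.round_eq_self F.zero_mem

theorem neg_mem (F : Format) {x : ℝ} (hx : x ∈ F.permissible) : -x ∈ F.permissible := by
  rcases hx with rfl | ⟨sa, a, sb, b, rfl⟩
  · simpa using F.zero_mem
  · refine Or.inr ⟨!sa, a, sb, b, ?_⟩
    cases sa <;> simp only [value, Bool.not_true, Bool.not_false, if_true, if_false,
      Bool.false_eq_true] <;> ring

/-- The normalized numbers `n * 2 ^ k` with `M + 1` significant bits are permissible. -/
theorem normalized_mem (F : Format) {n : ℕ} {k : ℤ} (h1 : 2 ^ F.M ≤ n) (h2 : n < 2 ^ (F.M + 1))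
    (hk1 : -F.emax ≤ k + F.M) (hk2 : k + F.M ≤ F.emax) :
    (n : ℝ) * (2 : ℝ) ^ k ∈ F.permissible := by
  obtain ⟨a, rfl⟩ := Nat.exists_eq_add_of_le h1
  have ha : a < 2 ^ F.M := by rw [pow_succ] at h2; omega
  unfold emax at hk1 hk2
  have hb : (k + F.M).natAbs < 2 ^ F.B := by zify; rw [abs_lt]; constructor <;> omega
  have key : ((2 ^ F.M + a : ℕ) : ℝ) * (2 : ℝ) ^ k
      = (1 + (a : ℝ) / 2 ^ F.M) * (2 : ℝ) ^ (k + F.M) := by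
    rw [zpow_add₀ (by norm_num), zpow_natCast]
    push_cast
    field_simp
  refine Or.inr ⟨false, ⟨a, ha⟩, decide (k + F.M < 0), ⟨(k + F.M).natAbs, hb⟩, ?_⟩
  rw [key]
  have hif : (if decide (k + F.M < 0) = true then -(((k + F.M).natAbs : ℕ) : ℤ)
      else (((k + F.M).natAbs : ℕ) : ℤ)) = k + F.M := by
    simp only [decide_eq_true_eq]; split_ifs <;> omega
  simp only [value, hif]
  simp

/-- A positive permissible number is normalized. -/
theorem exists_normalized (F : Format) {s : ℝ} (hs : s ∈ F.permissible) (hpos : 0 < s) :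
    ∃ (n : ℕ) (k : ℤ), 2 ^ F.M ≤ n ∧ n < 2 ^ (F.M + 1) ∧ s = (n : ℝ) * (2 : ℝ) ^ k := by
  rcases hs with rfl | ⟨sa, a, sb, b, rfl⟩
  · exact absurd hpos (lt_irrefl _)
  · set x : ℤ := if sb then -((b : ℕ) : ℤ) else ((b : ℕ) : ℤ) with hx
    cases sa
    · refine ⟨2 ^ F.M + a, x - F.M, by omega, by have := a.2; rw [pow_succ]; omega, ?_⟩
      simp only [value, ← hx]
      rw [zpow_sub₀ (by norm_num), zpow_natCast]
      push_cast
      simp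
      field_simp
    · exfalso
      have : 0 < (1 + ((a : ℕ) : ℝ) / 2 ^ F.M) * (2 : ℝ) ^ x := by positivity
      simp only [value, ← hx] at hpos
      simp at hpos
      linarith

/-- Natural multiples `n * 2 ^ k` with at most `q + 1 ≤ M + 1` significant bits are permissible. -/
theorem natCast_mul_zpow_mem (F : Format) {q n : ℕ} {k : ℤ} (hq : q ≤ F.M) (hn : n < 2 ^ (q + 1))
    (hk1 : -F.emax ≤ k) (hk2 : k + q ≤ F.emax) : (n : ℝ) * (2 : ℝ) ^ k ∈ F.permissible := by
  rcases Nat.eq_zero_or_pos n with rfl | hpos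
  · simpa using F.zero_mem
  · set l := Nat.log 2 n with hl
    have h1 : 2 ^ l ≤ n := Nat.pow_log_le_self 2 hpos.ne'
    have h2 : n < 2 ^ (l + 1) := Nat.lt_pow_succ_log_self (by norm_num) n
    have hlq : l ≤ q := by
      by_contra! h
      have := Nat.pow_le_pow_right (n := 2) (by norm_num) h
      omega
    have key : (n : ℝ) * (2 : ℝ) ^ k = ((n * 2 ^ (F.M - l) : ℕ) : ℝ) * (2 : ℝ) ^ (k - (F.M - l)) := by
      push_cast
      rw [zpow_sub₀ (by norm_num), mul_assoc]
      congr 1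
      have : ((F.M : ℤ) - l) = ((F.M - l : ℕ) : ℤ) := by omega
      rw [this, zpow_natCast]
      field_simp
    rw [key]
    have hp : 2 ^ F.M = 2 ^ l * 2 ^ (F.M - l) := by rw [← pow_add]; congr 1; omega
    apply F.normalized_mem
    · rw [hp]; exact Nat.mul_le_mul_right _ h1
    · rw [pow_succ, hp, mul_right_comm, ← pow_succ]
      exact Nat.mul_lt_mul_of_pos_right h2 (by positivity)
    · omega
    · omega

theorem intCast_mul_zpow_mem (F : Format) {q : ℕ} {n k : ℤ} (hq : q ≤ F.M)
    (hn : |n| < 2 ^ (q + 1)) (hk1 : -F.emax ≤ k) (hk2 : k + q ≤ F.emax) :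
    (n : ℝ) * (2 : ℝ) ^ k ∈ F.permissible := by
  have h := F.natCast_mul_zpow_mem (n := n.natAbs) hq (by zify; exact hn) hk1 hk2
  rcases Int.natAbs_eq n with h' | h'
  · have e : (n : ℝ) = (n.natAbs : ℝ) := by rw [← Int.cast_natCast, ← h']
    rw [e]; exact h
  · have e : (n : ℝ) = -(n.natAbs : ℝ) := by rw [← Int.cast_natCast, ← Int.cast_neg, ← h']
    rw [e, neg_mul]; exact F.neg_mem h

theorem zpow_mem (F : Format) {k : ℤ} (hk1 : -F.emax ≤ k) (hk2 : k ≤ F.emax) :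
    (2 : ℝ) ^ k ∈ F.permissible := by
  simpa using F.natCast_mul_zpow_mem (q := 0) (n := 1) (Nat.zero_le _) (by norm_num) hk1
    (by simpa using hk2)

theorem one_mem (F : Format) : (1 : ℝ) ∈ F.permissible := by
  have := F.emax_nonneg
  simpa using F.zpow_mem (k := 0) (by omega) (by omega)

/-- Adding at most half a unit in the last place does not change a positive number. -/
theorem round_add_of_le (F : Format) {n : ℕ} {k : ℤ} {δ : ℝ} (h1 : 2 ^ F.M ≤ n)
    (h2 : n < 2 ^ (F.M + 1)) (hk1 : -F.emax ≤ k + F.M) (hk2 : k + F.M ≤ F.emax) (hδ : 0 ≤ δ)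
    (hδ' : δ ≤ (2 : ℝ) ^ (k - 1)) :
    F.round ((n : ℝ) * (2 : ℝ) ^ k + δ) = (n : ℝ) * (2 : ℝ) ^ k := by
  refine F.isRounding_unique (F.round_spec _) ⟨F.normalized_mem h1 h2 hk1 hk2, fun s hs => ?_⟩
  have hk0 : (0 : ℝ) < (2 : ℝ) ^ k := by positivity
  have hx0 : 0 < (n : ℝ) * (2 : ℝ) ^ k := by
    have : (0 : ℝ) < n := by exact_mod_cast lt_of_lt_of_le (by positivity) h1
    positivity
  set x := (n : ℝ) * (2 : ℝ) ^ k with hx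
  have habs : |x + δ - x| = δ := by rw [add_sub_cancel_left, abs_of_nonneg hδ]
  rw [habs]
  rcases lt_trichotomy s x with hlt | rfl | hgt
  · left; rw [abs_of_pos (by linarith)]; linarith
  · right; rw [add_sub_cancel_left, abs_of_nonneg hδ]; exact ⟨rfl, le_rfl⟩
  · obtain ⟨n', k', h1', h2', hs'⟩ := F.exists_normalized hs (hx0.trans hgt)
    -- A larger permissible number has a unit at least as coarse, so it is an integer multiple of `2
    -- ^ k`; with a finer unit, normalization would keep it below `x`.
    have hgap : x + (2 : ℝ) ^ k ≤ s := by
      rcases le_or_gt k k' with hkk | hkk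
      · obtain ⟨j, rfl⟩ := Int.le.dest hkk
        have e1 : s = ((n' * 2 ^ j : ℕ) : ℝ) * (2 : ℝ) ^ k := by
          rw [hs', zpow_add₀ (by norm_num), zpow_natCast]; push_cast; ring
        rw [e1, hx] at hgt
        have hlt : n < n' * 2 ^ j := by exact_mod_cast lt_of_mul_lt_mul_right hgt hk0.le
        have : ((n : ℝ) + 1) ≤ ((n' * 2 ^ j : ℕ) : ℝ) := by exact_mod_cast hlt
        rw [e1, hx]
        nlinarith
      · exfalso
        have hle : (2 : ℝ) ^ (k' + 1) ≤ (2 : ℝ) ^ k :=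
          zpow_le_zpow_right₀ (by norm_num) (by omega)
        rw [zpow_add₀ (by norm_num), zpow_one] at hle
        have hn' : (n' : ℝ) ≤ 2 ^ F.M * 2 := by exact_mod_cast (by rw [← pow_succ]; exact h2'.le)
        have hn : (2 : ℝ) ^ F.M ≤ n := by exact_mod_cast h1
        have hk0' : (0 : ℝ) < (2 : ℝ) ^ k' := by positivity
        have : s ≤ x := by
          calc s = n' * (2 : ℝ) ^ k' := hs'
            _ ≤ (2 ^ F.M * 2) * (2 : ℝ) ^ k' := by gcongr
            _ = 2 ^ F.M * ((2 : ℝ) ^ k' * 2) := by ring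
            _ ≤ n * (2 : ℝ) ^ k := by gcongr
        linarith
    have hhalf : (2 : ℝ) ^ (k - 1) = (2 : ℝ) ^ k / 2 := by
      rw [zpow_sub₀ (by norm_num), zpow_one]
    rw [hhalf] at hδ'
    rw [abs_of_nonpos (by linarith : x + δ - s ≤ 0)]
    -- Equality is the tie `δ = 2 ^ (k - 1)`, which truncation decides in favour of the smaller
    -- number `x`.
    rcases lt_or_eq_of_le (show δ ≤ -(x + δ - s) by linarith) with h | h
    · exact Or.inl h
    · exact Or.inr ⟨h, by rw [abs_of_pos hx0, abs_of_pos (hx0.trans hgt)]; exact hgt.le⟩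

/-- There are fewer than `2 ^ bits` permissible numbers. -/
theorem ncard_permissible_lt (F : Format) : F.permissible.ncard < 2 ^ F.bits := by
  classical
  set S : Finset ℝ := insert 0 ((Finset.univ ×ˢ (Finset.range (2 ^ F.M) ×ˢ
      Finset.Icc (-F.emax) F.emax)).image fun x : Bool × ℕ × ℤ =>
        (if x.1 then -1 else 1) * (1 + (x.2.1 : ℝ) / 2 ^ F.M) * (2 : ℝ) ^ x.2.2) with hS
  have hsub : F.permissible ⊆ S := by
    rintro x (rfl | ⟨sa, a, sb, b, rfl⟩)
    · simp [hS]
    · simp only [hS, Finset.coe_insert, Finset.coe_image]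
      refine Or.inr ⟨(sa, a, if sb then -((b : ℕ) : ℤ) else ((b : ℕ) : ℤ)), ?_, rfl⟩
      have hb : ((b : ℕ) : ℤ) < 2 ^ F.B := by exact_mod_cast b.2
      have ha := a.2
      simp only [Finset.coe_product, Set.mem_prod, Finset.mem_coe, Finset.mem_univ,
        Finset.mem_range, Finset.mem_Icc, true_and]
      refine ⟨ha, ?_⟩
      unfold emax
      split_ifs <;> omega
  -- The exponents `+0` and `-0` coincide, which leaves `2 * 2 ^ B - 1` of them; the quadruples
  -- saved in this way outnumber the additional element zero.
  have hcard : S.card ≤ 2 * (2 ^ F.M * (2 * 2 ^ F.B - 1)) + 1 := by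
    refine (Finset.card_insert_le _ _).trans (Nat.add_le_add_right (Finset.card_image_le.trans ?_) 1)
    rw [Finset.card_product, Finset.card_product, Finset.card_univ, Fintype.card_bool,
      Finset.card_range, Int.card_Icc]
    gcongr
    unfold emax
    have : (2 : ℤ) ^ F.B = ((2 ^ F.B : ℕ) : ℤ) := by push_cast; rfl
    rw [this]
    omega
  have h := Set.ncard_le_ncard hsub S.finite_toSet
  rw [Set.ncard_coe_finset] at h
  refine lt_of_le_of_lt (h.trans hcard) ?_
  have e : 2 ^ F.bits = 2 * (2 ^ F.M * (2 * 2 ^ F.B)) := by unfold bits; ring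
  rw [e, Nat.mul_sub, Nat.mul_sub]
  have h1 : 1 ≤ 2 ^ F.M := Nat.one_le_two_pow
  have h2 : 1 ≤ 2 ^ F.B := Nat.one_le_two_pow
  have h3 : 2 ^ F.M * 1 ≤ 2 ^ F.M * (2 * 2 ^ F.B) := Nat.mul_le_mul_left _ (by omega)
  omega

end Format

/-! ### Left-to-right sums as accumulators. -/

/-- The value of an accumulator that starts at `s`, after the first `k` terms of `g` were added. -/
def run (ρ : ℝ → ℝ) (g : ℕ → ℝ) (s : ℝ) : ℕ → ℝ
  | 0 => s
  | k + 1 => add ρ (run ρ g s k) (g k)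

theorem run_add (ρ : ℝ → ℝ) (g : ℕ → ℝ) (s : ℝ) (k l : ℕ) :
    run ρ g s (k + l) = run ρ (fun i => g (k + i)) (run ρ g s k) l := by
  induction l with
  | zero => rfl
  | succ l ih => rw [← Nat.add_assoc, run, ih, run]

theorem run_congr {ρ : ℝ → ℝ} {g g' : ℕ → ℝ} {s s' : ℝ} {k : ℕ} (h : ∀ i < k, g i = g' i)
    (hs : s = s') : run ρ g s k = run ρ g' s' k := by
  induction k with
  | zero => exact hs
  | succ k ih => rw [run, run, ih fun i hi => h i (by omega), h k (by omega)]

theorem run_eq_of_step {ρ : ℝ → ℝ} {g : ℕ → ℝ} {s : ℝ} {k : ℕ} (P : ℕ → ℝ) (h0 : P 0 = s)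
    (h : ∀ i < k, add ρ (P i) (g i) = P (i + 1)) : run ρ g s k = P k := by
  induction k with
  | zero => exact h0.symm
  | succ k ih => rw [run, ih fun i hi => h i (by omega), h k (by omega)]

theorem lsum_eq_run (ρ : ℝ → ℝ) {k : ℕ} (x : Fin k → ℝ) (g : ℕ → ℝ) (h : ∀ i : Fin k, x i = g i) :
    lsum ρ x = run ρ g 0 k := by
  induction k with
  | zero => simp [lsum, run]
  | succ k ih =>
    rw [run, ← ih (fun i => x i.castSucc) fun i => by simpa using h i.castSucc]
    unfold lsum
    rw [List.ofFn_succ_last, List.foldl_append]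
    have := h (Fin.last k)
    simp only [Fin.val_last] at this
    simp [this]

theorem run_mem {F : Format} {g : ℕ → ℝ} {s : ℝ} (hs : s ∈ F.permissible) (k : ℕ) :
    run F.round g s k ∈ F.permissible := by
  cases k with
  | zero => exact hs
  | succ k => exact F.round_mem _

theorem lsum_one (ρ : ℝ → ℝ) (x : Fin 1 → ℝ) : lsum ρ x = add ρ 0 (x 0) := by
  simp [lsum, List.ofFn_succ]

theorem lsum_two (ρ : ℝ → ℝ) (x : Fin 2 → ℝ) : lsum ρ x = add ρ (add ρ 0 (x 0)) (x 1) := by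
  simp [lsum, List.ofFn_succ]

theorem lsum_three (ρ : ℝ → ℝ) (x : Fin 3 → ℝ) :
    lsum ρ x = add ρ (add ρ (add ρ 0 (x 0)) (x 1)) (x 2) := by
  simp [lsum, List.ofFn_succ]

namespace Transformer

variable {N : ℕ} {A : Type} {d dq dv dff : ℕ}

/-- The output in terms of the two accumulators. -/
theorem output_eq_run (T : Transformer N A d dq 1 dff) (F : Format) (σ : ℝ → ℝ)
    (x : Fin N → A) (i : Fin N) (gn gd : ℕ → ℝ)
    (hgn : ∀ j : Fin N, dot F.round (fun a => mul F.round (T.weight F σ x i j)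
      (T.embed j (x j) a)) (fun a => T.WV a 0) = gn j)
    (hgd : ∀ j : Fin N, T.weight F σ x i j = gd j) :
    T.output F σ x i =
      T.mlp F (fun _ => F.round (run F.round gn 0 N / run F.round gd 0 N)) := by
  have hden : T.denominator F σ x i = run F.round gd 0 N := lsum_eq_run F.round _ gd hgd
  have hnum : T.numerator F σ x i 0 = run F.round gn 0 N := lsum_eq_run F.round _ gn hgn
  have hatt : T.attention F σ x i = fun _ => F.round (run F.round gn 0 N / run F.round gd 0 N) := by
    funext c
    rw [Subsingleton.elim c 0, attention, hnum, hden]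
  rw [output, hatt]

end Transformer

/-! ### The lower bound: collision of accumulators. -/

theorem inputRep_congr_left {m n t e : ℕ} (y z z' : Fin m → Bool)
    {i : Fin n} (hi : (i : ℕ) < m) : inputRep n t e y z i = inputRep n t e y z' i := by
  unfold inputRep
  refine ite_congr rfl (fun _ => rfl) fun _ => ?_
  refine ite_congr rfl (fun _ => rfl) fun _ => ?_
  refine ite_congr rfl (fun _ => rfl) fun _ => ?_
  refine ite_congr rfl (fun _ => rfl) fun _ => ?_
  refine ite_congr rfl (fun _ => rfl) fun h => ?_
  omega

theorem inputRep_congr_right {m n t e : ℕ} (ht : 2 * t ≤ m) (ht0 : 0 < t) (y y' z : Fin m → Bool)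
    {i : Fin n} (hi : m ≤ (i : ℕ)) : inputRep n t e y z i = inputRep n t e y' z i := by
  have h1 : ¬ (i : ℕ) = 0 := by omega
  have h2 : ¬ (i : ℕ) ≤ t - 1 := by omega
  have h3 : ¬ (i : ℕ) ≤ 2 * t - 2 := by omega
  have h4 : ¬ (i : ℕ) = 2 * t - 1 := by omega
  have h5 : ¬ (i : ℕ) ≤ m - 1 := by omega
  unfold inputRep
  simp only [if_neg h1, if_neg h2, if_neg h3, if_neg h4, if_neg h5]

/-- The tokens of the input representation, followed by the placeholder. -/
def tokens {m : ℕ} (n t e : ℕ) (y z : Fin m → Bool) : Fin (n + 1) → Token e :=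
  Fin.snoc (inputRep n t e y z) (zeroToken e)

theorem tokens_last {m : ℕ} (n t e : ℕ) (y z : Fin m → Bool) :
    tokens n t e y z (Fin.last n) = zeroToken e := by
  simp [tokens]

theorem tokens_of_lt {m : ℕ} {n t e : ℕ} (y z : Fin m → Bool) {j : Fin (n + 1)}
    (h : (j : ℕ) < n) : tokens n t e y z j = inputRep n t e y z ⟨j, h⟩ := by
  have := Fin.snoc_castSucc (α := fun _ => Token e) (zeroToken e) (inputRep n t e y z) ⟨j, h⟩
  exact this

theorem tokens_congr_left {m n t e : ℕ} (hmn : m ≤ n) (y z z' : Fin m → Bool)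
    {j : Fin (n + 1)} (hj : (j : ℕ) < m) : tokens n t e y z j = tokens n t e y z' j := by
  rw [tokens_of_lt _ _ (by omega), tokens_of_lt _ _ (by omega)]
  exact inputRep_congr_left _ _ _ hj

theorem tokens_congr_right {m n t e : ℕ} (ht : 2 * t ≤ m) (ht0 : 0 < t) (y y' z : Fin m → Bool)
    {j : Fin (n + 1)} (hj : m ≤ (j : ℕ)) : tokens n t e y z j = tokens n t e y' z j := by
  rcases Nat.lt_or_ge (j : ℕ) n with h | h
  · rw [tokens_of_lt _ _ h, tokens_of_lt _ _ h]
    exact inputRep_congr_right ht ht0 _ _ _ hj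
  · obtain rfl : j = Fin.last n := Fin.ext (by simp; omega)
    rw [tokens_last, tokens_last]

/-- Formats whose pairs of numbers are fewer than the inputs cannot compute equality: two strings
lead to the same pair of accumulators after the first half of the input. -/
theorem not_computesEQ {p m n t e : ℕ} (hp : 1 < p) (hm : m = 2 * p - 1) (hmn : m ≤ n)
    (ht : 2 * t ≤ m) (ht0 : 0 < t) (he : 0 < e) (F : Format) (hF : F.bits ≤ p - 1) (σ : ℝ → ℝ)
    {d dq dff : ℕ} (hd : 0 < d) (T : Transformer (n + 1) (Token e) d dq 1 dff) :
    ¬ ComputesEQ m n t e hd T F σ := by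
  classical
  intro hT
  let gn : (Fin m → Bool) → (Fin m → Bool) → ℕ → ℝ := fun y z j =>
    if h : j < n + 1 then dot F.round (fun a => mul F.round
      (T.weight F σ (tokens n t e y z) (Fin.last n) ⟨j, h⟩)
      (T.embed ⟨j, h⟩ (tokens n t e y z ⟨j, h⟩) a)) (fun a => T.WV a 0) else 0
  let gd : (Fin m → Bool) → (Fin m → Bool) → ℕ → ℝ := fun y z j =>
    if h : j < n + 1 then T.weight F σ (tokens n t e y z) (Fin.last n) ⟨j, h⟩ else 0
  have hweight : ∀ y z z' : Fin m → Bool, ∀ j : Fin (n + 1), (j : ℕ) < m →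
      T.weight F σ (tokens n t e y z) (Fin.last n) j =
        T.weight F σ (tokens n t e y z') (Fin.last n) j := by
    intro y z z' j hj
    unfold Transformer.weight Transformer.score
    rw [tokens_last, tokens_last, tokens_congr_left hmn y z z' hj]
  have hgn : ∀ y z z' : Fin m → Bool, run F.round (gn y z) 0 m = run F.round (gn y z') 0 m := by
    intro y z z'
    refine run_congr (fun j hj => ?_) rfl
    have hj' : j < n + 1 := by omega
    simp only [gn, hj', dif_pos]
    rw [hweight y z z' _ hj, tokens_congr_left hmn y z z' hj]
  have hgd : ∀ y z z' : Fin m → Bool, run F.round (gd y z) 0 m = run F.round (gd y z') 0 m := by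
    intro y z z'
    refine run_congr (fun j hj => ?_) rfl
    have hj' : j < n + 1 := by omega
    simp only [gd, hj', dif_pos]
    rw [hweight y z z' _ hj]
  have hweight' : ∀ y y' z : Fin m → Bool, ∀ j : Fin (n + 1), m ≤ (j : ℕ) →
      T.weight F σ (tokens n t e y z) (Fin.last n) j =
        T.weight F σ (tokens n t e y' z) (Fin.last n) j := by
    intro y y' z j hj
    unfold Transformer.weight Transformer.score
    rw [tokens_last, tokens_last, tokens_congr_right ht ht0 y y' z hj]
  have hgn' : ∀ y y' z : Fin m → Bool, run F.round (gn y z) 0 m = run F.round (gn y' z) 0 m →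
      run F.round (gn y z) 0 (m + (n + 1 - m)) = run F.round (gn y' z) 0 (m + (n + 1 - m)) := by
    intro y y' z h
    rw [run_add, run_add]
    refine run_congr (fun j hj => ?_) h
    have hj' : m + j < n + 1 := by omega
    simp only [gn, hj', dif_pos]
    rw [hweight' y y' z _ (Nat.le_add_right m j),
      tokens_congr_right ht ht0 y y' z (Nat.le_add_right m j)]
  have hgd' : ∀ y y' z : Fin m → Bool, run F.round (gd y z) 0 m = run F.round (gd y' z) 0 m →
      run F.round (gd y z) 0 (m + (n + 1 - m)) = run F.round (gd y' z) 0 (m + (n + 1 - m)) := by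
    intro y y' z h
    rw [run_add, run_add]
    refine run_congr (fun j hj => ?_) h
    have hj' : m + j < n + 1 := by omega
    simp only [gd, hj', dif_pos]
    rw [hweight' y y' z _ (Nat.le_add_right m j)]
  have hout : ∀ y z : Fin m → Bool, T.output F σ (tokens n t e y z) (Fin.last n) =
      T.mlp F (fun _ => F.round (run F.round (gn y z) 0 (n + 1) /
        run F.round (gd y z) 0 (n + 1))) := fun y z =>
    T.output_eq_run F σ _ _ (gn y z) (gd y z) (fun j => by simp only [gn, j.2, dif_pos])
      (fun j => by simp only [gd, j.2, dif_pos])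
  -- strings that start with `0`
  let ext : (Fin (2 * p - 2) → Bool) → Fin m → Bool := fun f i =>
    if h : (i : ℕ) = 0 then false else f ⟨i - 1, by omega⟩
  have hext : Function.Injective ext := by
    intro f f' hff
    funext i
    have := congrFun hff ⟨i + 1, by omega⟩
    simpa [ext] using this
  have hprom : ∀ y f, binVal y ≤ binVal (ext f) → Promise e y (ext f) := by
    intro y f h
    refine ⟨h, 1, le_rfl, he, ?_⟩
    have : 1 ≤ m := by omega
    simp [bit, ext, this]
  let P := F.permissible_finite.toFinset
  have hP : P.card < 2 ^ (p - 1) := by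
    rw [← Set.ncard_eq_toFinset_card _ F.permissible_finite]
    exact F.ncard_permissible_lt.trans_le (Nat.pow_le_pow_right (by norm_num) hF)
  -- Fixing the first bit to `0` meets the promise and leaves `2 * p - 2` free bits, as many as two
  -- numbers of `p - 1` bits hold.
  have hcard : (P ×ˢ P).card < (Finset.univ : Finset (Fin (2 * p - 2) → Bool)).card := by
    rw [Finset.card_product, Finset.card_univ, Fintype.card_fun, Fintype.card_bool,
      Fintype.card_fin]
    have : 2 ^ (2 * p - 2) = 2 ^ (p - 1) * 2 ^ (p - 1) := by rw [← pow_add]; congr 1; omega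
    rw [this]
    exact Nat.mul_lt_mul'' hP hP
  obtain ⟨f, -, f', -, hne, heq⟩ := Finset.exists_ne_map_eq_of_card_lt_of_maps_to hcard
    (f := fun f => (run F.round (gn (ext f) (ext f)) 0 m, run F.round (gd (ext f) (ext f)) 0 m))
    (by
      intro f _
      simp only [Finset.coe_product, Set.mem_prod, Finset.mem_coe, P, Set.Finite.mem_toFinset]
      exact ⟨run_mem F.zero_mem m, run_mem F.zero_mem m⟩)
  -- The promise needs the first string to be the smaller one; hence the larger of the two colliding
  -- strings serves as the common second half.
  have main : ∀ f f', f ≠ f' → binVal (ext f) ≤ binVal (ext f') →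
      run F.round (gn (ext f) (ext f)) 0 m = run F.round (gn (ext f') (ext f')) 0 m →
      run F.round (gd (ext f) (ext f)) 0 m = run F.round (gd (ext f') (ext f')) 0 m → False := by
    intro f f' hne hle h1 h2
    have o1 := hT (ext f) (ext f') (hprom _ _ hle)
    have o2 := hT (ext f') (ext f') (hprom _ _ le_rfl)
    rw [if_neg (hext.ne hne)] at o1
    rw [if_pos rfl] at o2
    have : T.output F σ (tokens n t e (ext f) (ext f')) (Fin.last n) =
        T.output F σ (tokens n t e (ext f') (ext f')) (Fin.last n) := by
      have e1 := hgn' _ _ (ext f') ((hgn (ext f) (ext f') (ext f)).trans h1)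
      have e2 := hgd' _ _ (ext f') ((hgd (ext f) (ext f') (ext f)).trans h2)
      rw [show m + (n + 1 - m) = n + 1 by omega] at e1 e2
      rw [hout, hout, e1, e2]
    have := congrFun this ⟨0, hd⟩
    unfold tokens at this
    rw [o1, o2] at this
    exact zero_ne_one this
  simp only [Prod.mk.injEq] at heq
  rcases le_total (binVal (ext f)) (binVal (ext f')) with h | h
  · exact main f f' hne h heq.1 heq.2
  · exact main f' f hne.symm h heq.1.symm heq.2.symm

/-! ### Bit blocks as integers and as mantissas. -/

/-- The number whose binary expression is `g 0, …, g (k - 1)`. -/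
def bitsVal (g : ℕ → Bool) : ℕ → ℕ
  | 0 => 0
  | k + 1 => 2 * bitsVal g k + (g k).toNat

theorem bitsVal_lt (g : ℕ → Bool) (k : ℕ) : bitsVal g k < 2 ^ k := by
  induction k with
  | zero => simp [bitsVal]
  | succ k ih =>
    have := Bool.toNat_le (g k)
    rw [bitsVal, pow_succ]
    omega

theorem bitsVal_add (g : ℕ → Bool) (k l : ℕ) :
    bitsVal g (k + l) = 2 ^ l * bitsVal g k + bitsVal (fun i => g (k + i)) l := by
  induction l with
  | zero => simp [bitsVal]
  | succ l ih => rw [← Nat.add_assoc, bitsVal, ih, bitsVal, pow_succ]; ring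

theorem bitsVal_congr {g g' : ℕ → Bool} {k : ℕ} (h : ∀ i < k, g i = g' i) :
    bitsVal g k = bitsVal g' k := by
  induction k with
  | zero => rfl
  | succ k ih => rw [bitsVal, bitsVal, ih fun i hi => h i (by omega), h k (by omega)]

theorem eq_of_bitsVal_eq {g g' : ℕ → Bool} {k : ℕ} (h : bitsVal g k = bitsVal g' k) :
    ∀ i < k, g i = g' i := by
  induction k with
  | zero => intro i hi; omega
  | succ k ih =>
    have h1 := Bool.toNat_le (g k)
    have h2 := Bool.toNat_le (g' k)
    simp only [bitsVal] at h
    have hk : g k = g' k := by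
      have : (g k).toNat = (g' k).toNat := by omega
      cases hg : g k <;> cases hg' : g' k <;> simp_all
    intro i hi
    rcases Nat.lt_succ_iff_lt_or_eq.mp hi with h' | rfl
    · exact ih (by omega) i h'
    · exact hk

theorem binVal_eq_bitsVal {m : ℕ} (y : Fin m → Bool) :
    binVal y = bitsVal (fun i => bit y (i + 1)) m := by
  have key : ∀ (g : ℕ → Bool) (k : ℕ),
      bitsVal g k = ∑ i ∈ Finset.range k, if g i then 2 ^ (k - 1 - i) else 0 := by
    intro g k
    induction k with
    | zero => simp [bitsVal]
    | succ k ih =>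
      rw [bitsVal, ih, Finset.sum_range_succ, Finset.mul_sum]
      congr 1
      · refine Finset.sum_congr rfl fun i hi => ?_
        have := Finset.mem_range.mp hi
        rw [mul_ite, ← pow_succ', mul_zero, show k - 1 - i + 1 = k + 1 - 1 - i by omega]
      · cases g k <;> simp
  rw [key, binVal, Finset.sum_range]
  refine Finset.sum_congr rfl fun i _ => ?_
  have : (i : ℕ) + 1 ≤ m := i.2
  simp [bit, this]

/-- Comparing binary numbers by a leading block of bits, and then by a second block. -/
theorem bitsVal_lt_or_of_le {g g' : ℕ → Bool} {k l r : ℕ}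
    (h : bitsVal g (k + l + r) ≤ bitsVal g' (k + l + r)) :
    bitsVal g k < bitsVal g' k ∨ bitsVal g k = bitsVal g' k ∧
      bitsVal (fun i => g (k + i)) l ≤ bitsVal (fun i => g' (k + i)) l := by
  have aux : ∀ {a b c d s : ℕ}, c < 2 ^ s → d < 2 ^ s → 2 ^ s * a + c ≤ 2 ^ s * b + d → a ≤ b := by
    intro a b c d s hc hd hle
    by_contra! hlt
    have : 2 ^ s * (b + 1) ≤ 2 ^ s * a := Nat.mul_le_mul_left _ hlt
    rw [Nat.mul_add] at this
    omega
  rw [bitsVal_add g, bitsVal_add g'] at h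
  have h1 := aux (bitsVal_lt _ r) (bitsVal_lt _ r) h
  rw [bitsVal_add g, bitsVal_add g'] at h1
  have h2 := aux (bitsVal_lt _ l) (bitsVal_lt _ l) h1
  rcases h2.lt_or_eq with h3 | h3
  · exact Or.inl h3
  · right
    rw [h3] at h1
    exact ⟨h3, by omega⟩

/-- The number `2 ^ κ * 1.f` with the first `i` bits of the fraction `f`. -/
noncomputable def mant (κ : ℤ) (f : ℕ → Bool) (i : ℕ) : ℝ :=
  ((2 ^ i + bitsVal f i : ℕ) : ℝ) * (2 : ℝ) ^ (κ - i)

theorem mant_zero (κ : ℤ) (f : ℕ → Bool) : mant κ f 0 = (2 : ℝ) ^ κ := by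
  simp [mant, bitsVal]

theorem mant_succ (κ : ℤ) (f : ℕ → Bool) (i : ℕ) :
    mant κ f (i + 1) = mant κ f i + if f i then (2 : ℝ) ^ (κ - (i + 1 : ℕ)) else 0 := by
  have h : (2 : ℝ) ^ (κ - (i : ℤ)) = 2 * (2 : ℝ) ^ (κ - ((i + 1 : ℕ) : ℤ)) := by
    rw [← zpow_one_add₀ (by norm_num)]; congr 1; push_cast; ring
  rw [mant, mant, bitsVal, h]
  cases f i <;> simp <;> ring

theorem zpow_mul_mant (s κ : ℤ) (f : ℕ → Bool) (i : ℕ) :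
    (2 : ℝ) ^ s * mant κ f i = mant (s + κ) f i := by
  rw [mant, mant, add_sub_assoc, zpow_add₀ (by norm_num)]
  ring

theorem mant_congr {κ κ' : ℤ} {f f' : ℕ → Bool} {i : ℕ} (hκ : κ = κ')
    (h : bitsVal f i = bitsVal f' i) : mant κ f i = mant κ' f' i := by
  rw [mant, mant, hκ, h]

theorem zpow_le_mant (κ : ℤ) (f : ℕ → Bool) (i : ℕ) : (2 : ℝ) ^ κ ≤ mant κ f i := by
  have : (2 : ℝ) ^ κ = 2 ^ i * (2 : ℝ) ^ (κ - i) := by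
    rw [← zpow_natCast, ← zpow_add₀ (by norm_num)]; congr 1; ring
  rw [mant, this]
  gcongr
  push_cast
  linarith [(Nat.cast_nonneg (bitsVal f i) : (0 : ℝ) ≤ _)]

theorem mant_pos (κ : ℤ) (f : ℕ → Bool) (i : ℕ) : 0 < mant κ f i :=
  lt_of_lt_of_le (by positivity) (zpow_le_mant κ f i)

theorem mant_add_le (κ : ℤ) (f : ℕ → Bool) (i : ℕ) :
    mant κ f i + (2 : ℝ) ^ (κ - i) ≤ (2 : ℝ) ^ (κ + 1) := by
  have h : (2 : ℝ) ^ (κ + 1) = 2 ^ (i + 1) * (2 : ℝ) ^ (κ - i) := by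
    rw [← zpow_natCast, ← zpow_add₀ (by norm_num)]; congr 1; push_cast; ring
  have hv : 2 ^ i + bitsVal f i + 1 ≤ 2 ^ (i + 1) := by
    have := bitsVal_lt f i
    rw [pow_succ]; omega
  have hv' : ((2 ^ i + bitsVal f i : ℕ) : ℝ) + 1 ≤ 2 ^ (i + 1) := by exact_mod_cast hv
  rw [h, mant]
  have : (0 : ℝ) < (2 : ℝ) ^ (κ - i) := by positivity
  nlinarith

/-- Distinct numbers with `i` bits of fraction differ by a relative error of `2 ^ (-(i + 1))`. -/
theorem mant_gap {κ κ' : ℤ} {f f' : ℕ → Bool} {i : ℕ}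
    (h : κ < κ' ∨ κ = κ' ∧ bitsVal f i < bitsVal f' i) :
    mant κ f i * (1 + (2 : ℝ) ^ (-(i + 1 : ℤ))) ≤ mant κ' f' i ∧
      mant κ f i ≤ mant κ' f' i * (1 - (2 : ℝ) ^ (-(i + 1 : ℤ))) := by
  have hu : (2 : ℝ) ^ (κ + 1) * (2 : ℝ) ^ (-(i + 1 : ℤ)) = (2 : ℝ) ^ (κ - i) := by
    rw [← zpow_add₀ (by norm_num)]; congr 1; ring
  have h0 : (0 : ℝ) < (2 : ℝ) ^ (-(i + 1 : ℤ)) := by positivity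
  have hκ0 : (0 : ℝ) < (2 : ℝ) ^ (κ - i) := by positivity
  have h1 : mant κ f i + (2 : ℝ) ^ (κ - i) ≤ (2 : ℝ) ^ (κ + 1) := mant_add_le κ f i
  have hlt : (2 : ℝ) ^ (-(i + 1 : ℤ)) ≤ 1 := by
    rw [show (1 : ℝ) = (2 : ℝ) ^ (0 : ℤ) by simp]
    exact zpow_le_zpow_right₀ (by norm_num) (by omega)
  -- The mantissa stays below `2 ^ (κ + 1)`, so one unit `2 ^ (κ - i)` is at least the fraction `2 ^
  -- (-(i + 1))` of it.
  have h5 : mant κ f i * (2 : ℝ) ^ (-(i + 1 : ℤ)) ≤ (2 : ℝ) ^ (κ - i) := by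
    rw [← hu]; gcongr; linarith
  rcases h with h | ⟨rfl, h⟩
  · have h2 : (2 : ℝ) ^ (κ + 1) ≤ mant κ' f' i :=
      (zpow_le_zpow_right₀ (by norm_num) (by omega)).trans (zpow_le_mant κ' f' i)
    refine ⟨by linarith, ?_⟩
    have : (2 : ℝ) ^ (κ + 1) * (1 - (2 : ℝ) ^ (-(i + 1 : ℤ))) ≤
        mant κ' f' i * (1 - (2 : ℝ) ^ (-(i + 1 : ℤ))) := by
      gcongr
    rw [mul_sub, hu] at this
    linarith
  · have hv : ((2 ^ i + bitsVal f i : ℕ) : ℝ) + 1 ≤ ((2 ^ i + bitsVal f' i : ℕ) : ℝ) := by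
      exact_mod_cast (by omega)
    have hstep : mant κ f i + (2 : ℝ) ^ (κ - i) ≤ mant κ f' i := by
      rw [mant, mant]; nlinarith
    refine ⟨by linarith, ?_⟩
    have h6 : mant κ f' i * (2 : ℝ) ^ (-(i + 1 : ℤ)) ≤ (2 : ℝ) ^ (κ - i) := by
      rw [← hu]; gcongr; linarith [mant_add_le κ f' i]
    linarith

/-! ### Exact additions and absorbed additions. -/

namespace Format

variable (F : Format)

theorem mant_mem {κ : ℤ} (f : ℕ → Bool) {i : ℕ} (hi : i ≤ F.M) (h1 : -F.emax ≤ κ - i)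
    (h2 : κ ≤ F.emax) : mant κ f i ∈ F.permissible := by
  refine F.natCast_mul_zpow_mem hi ?_ h1 (by omega)
  have := bitsVal_lt f i
  rw [pow_succ]; omega

/-- With equal exponents the difference is a multiple of `2 ^ (κ - q)` by an integer below `2 ^ (q +
1)`, so it fits into the mantissa. This makes the subtraction of the upper halves exact at every
partial sum. -/
theorem mant_sub_mant_mem {κ : ℤ} (f f' : ℕ → Bool) {i q : ℕ} (hi : i ≤ q) (hq : q ≤ F.M)
    (h1 : -F.emax ≤ κ - q) (h2 : κ ≤ F.emax) :
    mant κ f i - mant κ f' q ∈ F.permissible := by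
  obtain ⟨r, rfl⟩ := Nat.exists_eq_add_of_le hi
  have e : mant κ f i - mant κ f' (i + r) =
      (((2 ^ i + bitsVal f i) * 2 ^ r - (2 ^ (i + r) + bitsVal f' (i + r)) : ℤ) : ℝ) *
        (2 : ℝ) ^ (κ - (i + r : ℕ)) := by
    have : (2 : ℝ) ^ (κ - i) = 2 ^ r * (2 : ℝ) ^ (κ - (i + r : ℕ)) := by
      rw [← zpow_natCast, ← zpow_add₀ (by norm_num)]; congr 1; push_cast; ring
    rw [mant, mant, this]
    push_cast
    ring
  rw [e]
  refine F.intCast_mul_zpow_mem hq ?_ h1 (by omega)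
  have b1 : ((bitsVal f i : ℕ) : ℤ) + 1 ≤ 2 ^ i := by exact_mod_cast bitsVal_lt f i
  have b2 : ((bitsVal f' (i + r) : ℕ) : ℤ) + 1 ≤ 2 ^ (i + r) := by exact_mod_cast bitsVal_lt f' _
  have b3 : (0 : ℤ) ≤ bitsVal f i := by positivity
  have b4 : (0 : ℤ) ≤ bitsVal f' (i + r) := by positivity
  have b5 : (0 : ℤ) < 2 ^ r := by positivity
  have b6 : (0 : ℤ) < 2 ^ (i + r) := by positivity
  have b7 : ((2 : ℤ) ^ i + bitsVal f i) * 2 ^ r ≤ 2 * 2 ^ (i + r) := by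
    rw [pow_add]; nlinarith
  have b8 : 0 ≤ ((2 : ℤ) ^ i + bitsVal f i) * 2 ^ r := by positivity
  rw [abs_lt, pow_succ]
  constructor
  · linarith
  · linarith

theorem round_mant_add {κ : ℤ} (f : ℕ → Bool) {i : ℕ} {δ : ℝ} (hi : i ≤ F.M) (h1 : -F.emax ≤ κ)
    (h2 : κ ≤ F.emax) (hδ : 0 ≤ δ) (hδ' : δ ≤ (2 : ℝ) ^ (κ - F.M - 1)) :
    F.round (mant κ f i + δ) = mant κ f i := by
  obtain ⟨r, hr⟩ := Nat.exists_eq_add_of_le hi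
  have e : mant κ f i = (((2 ^ i + bitsVal f i) * 2 ^ r : ℕ) : ℝ) * (2 : ℝ) ^ (κ - F.M) := by
    have : (2 : ℝ) ^ (κ - i) = 2 ^ r * (2 : ℝ) ^ (κ - F.M) := by
      rw [← zpow_natCast, ← zpow_add₀ (by norm_num)]; congr 1; rw [hr]; push_cast; ring
    rw [mant, this]
    push_cast
    ring
  rw [e]
  have := bitsVal_lt f i
  refine F.round_add_of_le ?_ ?_ (by omega) (by omega) hδ hδ'
  · rw [hr, pow_add]; exact Nat.mul_le_mul_right _ (Nat.le_add_right _ _)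
  · rw [hr, show i + r + 1 = (i + 1) + r by ring, pow_add]
    exact Nat.mul_lt_mul_of_pos_right (by rw [pow_succ]; omega) (by positivity)

theorem add_eq {x y : ℝ} (hx : x ∈ F.permissible) (hy : y ∈ F.permissible) :
    add F.round x y = F.round (x + y) := by
  rw [add, F.round_eq_self hx, F.round_eq_self hy]

theorem add_exact {x y : ℝ} (hx : x ∈ F.permissible) (hy : y ∈ F.permissible)
    (hxy : x + y ∈ F.permissible) : add F.round x y = x + y := by
  rw [F.add_eq hx hy, F.round_eq_self hxy]

theorem mul_eq {x y : ℝ} (hx : x ∈ F.permissible) (hy : y ∈ F.permissible) :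
    mul F.round x y = F.round (x * y) := by
  rw [mul, F.round_eq_self hx, F.round_eq_self hy]

end Format

/-! ### Evaluation of the accumulators. -/

theorem run_const {F : Format} {g : ℕ → ℝ} {s : ℝ} {k : ℕ}
    (h : ∀ i < k, add F.round s (g i) = s) : run F.round g s k = s :=
  run_eq_of_step (fun _ => s) rfl h

theorem run_zero {F : Format} {g : ℕ → ℝ} {s : ℝ} {k : ℕ} (hs : s ∈ F.permissible)
    (h : ∀ i < k, g i = 0) : run F.round g s k = s :=
  run_const fun i hi => by
    rw [h i hi, F.add_eq hs F.zero_mem, add_zero, F.round_eq_self hs]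

theorem le_run {F : Format} {g : ℕ → ℝ} {s U : ℝ} {k : ℕ} (hU : U ∈ F.permissible)
    (hs : s ∈ F.permissible) (h : U ≤ s) (hg : ∀ i < k, 0 ≤ g i) : U ≤ run F.round g s k := by
  induction k with
  | zero => exact h
  | succ k ih =>
    have h1 := ih fun i hi => hg i (by omega)
    have h2 := F.round_nonneg (hg k (by omega))
    rw [run, add, F.round_eq_self (run_mem hs k)]
    exact F.le_round hU (by linarith)

/-- The rounded sum is not computed: each step at most doubles the power-of-two bound. The crude
bound suffices because exponents are cheap. -/
theorem run_const_le {F : Format} {g : ℕ → ℝ} {A : ℤ} {k : ℕ} (hA : -F.emax ≤ A)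
    (hk : A + k ≤ F.emax) (hg : ∀ i < k, g i = (2 : ℝ) ^ A) :
    run F.round g 0 k ≤ (2 : ℝ) ^ (A + k) := by
  induction k with
  | zero => simp only [run]; positivity
  | succ k ih =>
    push_cast at hk
    have h1 := ih (by omega) fun i hi => hg i (by omega)
    rw [run, hg k (by omega), F.add_eq (run_mem F.zero_mem k) (F.zpow_mem hA (by omega))]
    refine F.round_le (F.zpow_mem (by push_cast; omega) (by push_cast; omega)) ?_
    have h2 : (2 : ℝ) ^ A ≤ (2 : ℝ) ^ (A + k) := zpow_le_zpow_right₀ (by norm_num) (by omega)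
    have h3 : (2 : ℝ) ^ (A + (k + 1 : ℕ)) = (2 : ℝ) ^ (A + k) * 2 := by
      rw [← zpow_add_one₀ (by norm_num)]; congr 1; push_cast; ring
    linarith

/-- A number `± 1.f * 2 ^ κ` is added to the accumulator: the leading bit, then the fraction. -/
theorem run_mant {F : Format} {g : ℕ → ℝ} {s c : ℝ} {κ : ℤ} {f : ℕ → Bool} {q : ℕ}
    (hs : s ∈ F.permissible) (hg : ∀ i < q + 1, g i ∈ F.permissible)
    (hsum : ∀ i ≤ q, s + c * mant κ f i ∈ F.permissible) (h0 : g 0 = c * (2 : ℝ) ^ κ)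
    (h : ∀ i < q, g (i + 1) = c * if f i then (2 : ℝ) ^ (κ - (i + 1 : ℕ)) else 0) :
    run F.round g s (q + 1) = s + c * mant κ f q := by
  have := run_eq_of_step (ρ := F.round) (g := g) (s := s) (k := q + 1)
    (fun i => match i with | 0 => s | i + 1 => s + c * mant κ f i) rfl ?_
  · exact this
  intro i hi
  cases i with
  | zero =>
    have h1 := hsum 0 (Nat.zero_le _)
    have h2 := hg 0 (by omega)
    rw [mant_zero, ← h0] at h1
    simp only [mant_zero]
    rw [F.add_exact hs h2 h1, h0]
  | succ i =>
    have e : s + c * mant κ f (i + 1) = s + c * mant κ f i + g (i + 1) := by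
      rw [h i (by omega), mant_succ]; ring
    have h1 := hsum (i + 1) (by omega)
    rw [e] at h1
    simp only [e]
    exact F.add_exact (hsum i (by omega)) (hg _ hi) h1

/-- A number `1.f * 2 ^ κ` is added to the accumulator, where the leading bit comes together with
the first bit of the fraction. -/
theorem run_mant_one {F : Format} {g : ℕ → ℝ} {κ : ℤ} {f : ℕ → Bool} {q : ℕ} (hq0 : 0 < q)
    (hq : q ≤ F.M) (hκ : -F.emax ≤ κ - q) (hκ' : κ ≤ F.emax) (h0 : g 0 = mant κ f 1)
    (h : ∀ i, 0 < i → i < q → g i = if f i then (2 : ℝ) ^ (κ - (i + 1 : ℕ)) else 0) :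
    run F.round g 0 q = mant κ f q := by
  have hm : ∀ i ≤ q, mant κ f i ∈ F.permissible := fun i hi =>
    F.mant_mem f (by omega) (by omega) hκ'
  obtain ⟨r, rfl⟩ : ∃ r, q = r + 1 := ⟨q - 1, by omega⟩
  have := run_eq_of_step (ρ := F.round) (g := g) (s := 0) (k := r + 1)
    (fun i => match i with | 0 => 0 | i + 1 => mant κ f (i + 1)) rfl ?_
  · exact this
  intro i hi
  cases i with
  | zero =>
    simp only [h0, zero_add]
    have := hm 1 (by omega)
    rw [F.add_exact F.zero_mem this (by rwa [zero_add]), zero_add]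
  | succ i =>
    simp only [h (i + 1) (by omega) hi]
    have h1 := hm (i + 1 + 1) (by omega)
    rw [mant_succ] at h1
    rw [mant_succ κ f (i + 1)]
    refine F.add_exact (hm _ (by omega)) ?_ h1
    split_ifs
    · exact F.zpow_mem (by push_cast; omega) (by push_cast; omega)
    · exact F.zero_mem

/-- The accumulator of the denominator: small weights, then `1.f * 2 ^ κ`, then small weights. -/
theorem run_denominator {F : Format} {G : ℕ → ℝ} {A κ : ℤ} {f : ℕ → Bool} {t q N : ℕ}
    (hq0 : 0 < q) (hq : q ≤ F.M) (hA : -F.emax ≤ A) (hκ : A + t ≤ κ - F.M - 1)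
    (hκ' : κ ≤ F.emax) (hκq : -F.emax ≤ κ - q) (hN : t + q ≤ N)
    (h1 : ∀ i < t, G i = (2 : ℝ) ^ A) (h2 : G t = mant κ f 1)
    (h3 : ∀ i, 0 < i → i < q → G (t + i) =
      if f i then (2 : ℝ) ^ (κ - (i + 1 : ℕ)) else (2 : ℝ) ^ A)
    (h4 : ∀ j, t + q ≤ j → j < N → G j = (2 : ℝ) ^ A) :
    run F.round G 0 N = mant κ f q := by
  have hwA : (2 : ℝ) ^ A ∈ F.permissible := F.zpow_mem hA (by omega)
  have hm : ∀ i ≤ q, mant κ f i ∈ F.permissible := fun i hi =>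
    F.mant_mem f (by omega) (by omega) hκ'
  have habs : ∀ i ≤ q, add F.round (mant κ f i) ((2 : ℝ) ^ A) = mant κ f i := by
    intro i hi
    rw [F.add_eq (hm i hi) hwA]
    exact F.round_mant_add f (by omega) (by omega) hκ' (by positivity)
      (zpow_le_zpow_right₀ (by norm_num) (by omega))
  obtain ⟨r, rfl⟩ := Nat.exists_eq_add_of_le hN
  obtain ⟨q, rfl⟩ : ∃ q', q = q' + 1 := ⟨q - 1, by omega⟩
  -- Here the roles are exchanged: the accumulated small weights are the term that is absorbed by
  -- the arriving large one.
  have s1 : run F.round G 0 (t + 1) = mant κ f 1 := by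
    have hle : run F.round G 0 t ≤ (2 : ℝ) ^ (A + t) := run_const_le hA (by omega) h1
    have hge : 0 ≤ run F.round G 0 t := le_run F.zero_mem F.zero_mem le_rfl fun i hi => by
      rw [h1 i hi]; positivity
    rw [run, h2, F.add_eq (run_mem F.zero_mem t) (hm 1 (by omega)), add_comm]
    refine F.round_mant_add f (by omega) (by omega) hκ' hge (hle.trans ?_)
    exact zpow_le_zpow_right₀ (by norm_num) (by omega)
  have s2 : run F.round G 0 (t + 1 + q) = mant κ f (q + 1) := by
    rw [run_add, s1]
    refine run_eq_of_step (fun i => mant κ f (i + 1)) rfl fun i hi => ?_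
    have e := h3 (i + 1) (by omega) (by omega)
    rw [show t + (i + 1) = t + 1 + i by ring] at e
    rw [e, mant_succ κ f (i + 1)]
    by_cases hf : f (i + 1)
    · have h1 := hm (i + 1 + 1) (by omega)
      rw [mant_succ, if_pos hf] at h1
      rw [if_pos hf, if_pos hf]
      exact F.add_exact (hm _ (by omega)) (F.zpow_mem (by push_cast; omega) (by push_cast; omega)) h1
    · rw [if_neg hf, if_neg hf, add_zero]
      exact habs _ (by omega)
  rw [show t + (q + 1) + r = t + 1 + q + r by ring, run_add, s2]
  refine run_const fun i hi => ?_
  rw [h4 _ (by omega) (by omega)]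
  exact habs _ le_rfl

/-- The accumulator of the numerator: `1.f * 2 ^ κ` is subtracted, then `1.f' * 2 ^ κ'` and
`1.h * 2 ^ μ` are added. -/
structure NumeratorTerms (G : ℕ → ℝ) (κ κ' μ : ℤ) (f f' h : ℕ → Bool) (q r m N : ℕ) : Prop where
  head : G 0 = -(2 : ℝ) ^ κ
  frac : ∀ i < q, G (i + 1) = -if f i then (2 : ℝ) ^ (κ - (i + 1 : ℕ)) else 0
  gap : ∀ j, q + 1 ≤ j → j < m → G j = 0
  head' : G m = (2 : ℝ) ^ κ'
  frac' : ∀ i < q, G (m + (i + 1)) = if f' i then (2 : ℝ) ^ (κ' - (i + 1 : ℕ)) else 0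
  low : G (m + (q + 1)) = mant μ h 1
  lowFrac : ∀ i, 0 < i → i < r → G (m + (q + 1) + i) =
    if h i then (2 : ℝ) ^ (μ - (i + 1 : ℕ)) else 0
  tail : ∀ j, m + (q + 1) + r ≤ j → j < N → G j = 0

namespace NumeratorTerms

variable {F : Format} {G : ℕ → ℝ} {κ κ' μ : ℤ} {f f' h : ℕ → Bool} {q r m N : ℕ}

theorem run_first (hG : NumeratorTerms G κ κ' μ f f' h q r m N) (hq : q ≤ F.M)
    (hκ : -F.emax ≤ κ - q) (hκ2 : κ ≤ F.emax) (hm : q + 1 ≤ m) :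
    run F.round G 0 m = -mant κ f q := by
  have hmem : ∀ i ≤ q, mant κ f i ∈ F.permissible := fun i hi =>
    F.mant_mem f (by omega) (by omega) hκ2
  obtain ⟨l, rfl⟩ := Nat.exists_eq_add_of_le hm
  have s1 : run F.round G 0 (q + 1) = -mant κ f q := by
    rw [run_mant (c := -1) (κ := κ) (f := f) F.zero_mem, zero_add, neg_one_mul]
    · intro i hi
      cases i with
      | zero => rw [hG.head]; exact F.neg_mem (F.zpow_mem (by omega) hκ2)
      | succ i =>
        rw [hG.frac i (by omega)]
        split_ifs
        · exact F.neg_mem (F.zpow_mem (by push_cast; omega) (by push_cast; omega))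
        · exact F.neg_mem F.zero_mem
    · intro i hi
      rw [zero_add, neg_one_mul]; exact F.neg_mem (hmem i hi)
    · rw [hG.head]; ring
    · intro i hi
      rw [hG.frac i hi]; ring
  rw [run_add, s1]
  exact run_zero (F.neg_mem (hmem q le_rfl)) fun i hi => hG.gap _ (by omega) (by omega)

theorem term_nonneg (hG : NumeratorTerms G κ κ' μ f f' h q r m N) {j : ℕ} (hj : m ≤ j)
    (hjN : j < N) : 0 ≤ G j := by
  obtain ⟨i, rfl⟩ := Nat.exists_eq_add_of_le hj
  rcases Nat.eq_zero_or_pos i with rfl | hi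
  · rw [Nat.add_zero, hG.head']; positivity
  rcases Nat.lt_or_ge i (q + 1) with h1 | h1
  · obtain ⟨i, rfl⟩ : ∃ i', i = i' + 1 := ⟨i - 1, by omega⟩
    rw [hG.frac' i (by omega)]; split_ifs <;> positivity
  obtain ⟨i, rfl⟩ := Nat.exists_eq_add_of_le h1
  rw [← Nat.add_assoc] at hjN ⊢
  rcases Nat.eq_zero_or_pos i with rfl | hi
  · rw [Nat.add_zero, hG.low]; exact (mant_pos _ _ _).le
  rcases Nat.lt_or_ge i r with h2 | h2
  · rw [hG.lowFrac i hi h2]; split_ifs <;> positivity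
  · rw [hG.tail _ (by omega) hjN]

/-- Equal exponents are essential: for `κ < κ'` the partial differences need not be representable,
and only lower bounds are available. -/
theorem run_second (hG : NumeratorTerms G κ κ' μ f f' h q r m N) (hq : q ≤ F.M)
    (hκ : -F.emax ≤ κ - q) (hκ2 : κ ≤ F.emax) (hm : q + 1 ≤ m) (hκκ : κ = κ') :
    run F.round G 0 (m + (q + 1)) = mant κ f' q - mant κ f q := by
  subst hκκ
  rw [run_add, hG.run_first hq hκ hκ2 hm, run_mant (c := 1) (κ := κ) (f := f'), one_mul]
  · ring
  · exact F.neg_mem (F.mant_mem f hq hκ hκ2)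
  · intro i hi
    cases i with
    | zero => rw [Nat.add_zero, hG.head']; exact F.zpow_mem (by omega) hκ2
    | succ i =>
      rw [hG.frac' i (by omega)]
      split_ifs
      · exact F.zpow_mem (by push_cast; omega) (by push_cast; omega)
      · exact F.zero_mem
  · intro i hi
    rw [one_mul, neg_add_eq_sub]
    exact F.mant_sub_mant_mem f' f hi hq hκ hκ2
  · rw [Nat.add_zero, hG.head', one_mul]
  · intro i hi
    rw [hG.frac' i hi, one_mul]

theorem run_eq (hG : NumeratorTerms G κ κ' μ f f' h q r m N) (hq : q ≤ F.M)
    (hκ : -F.emax ≤ κ - q) (hκ2 : κ ≤ F.emax) (hm : q + 1 ≤ m) (hr0 : 0 < r) (hr : r ≤ F.M)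
    (hμ : -F.emax ≤ μ - r) (hμ2 : μ ≤ F.emax) (hN : m + (q + 1) + r ≤ N)
    (hκκ : κ = κ') (hff : bitsVal f q = bitsVal f' q) : run F.round G 0 N = mant μ h r := by
  obtain ⟨l, rfl⟩ := Nat.exists_eq_add_of_le hN
  have s2 := hG.run_second hq hκ hκ2 hm hκκ
  rw [mant_congr rfl hff.symm, sub_self] at s2
  have s3 : run F.round G 0 (m + (q + 1) + r) = mant μ h r := by
    rw [run_add, s2]
    exact run_mant_one hr0 hr hμ hμ2 hG.low hG.lowFrac
  rw [run_add, s3]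
  exact run_zero (F.mant_mem h hr hμ hμ2) fun i hi => hG.tail _ (by omega) (by omega)

/-- If the exponents differ, the leading bit of `z` alone exceeds the whole upper half of `y` by a
unit; if only the fractions differ, the exact difference does. All later terms are nonnegative, so
the accumulator never drops below this permissible bound. -/
theorem le_run (hG : NumeratorTerms G κ κ' μ f f' h q r m N) (hq : q ≤ F.M)
    (hκ : -F.emax ≤ κ - q) (hκ2 : κ ≤ F.emax) (hκ3 : κ' ≤ F.emax) (hm : q + 1 ≤ m)
    (hN : m + (q + 1) ≤ N)
    (hlt : κ < κ' ∨ κ = κ' ∧ bitsVal f q < bitsVal f' q) :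
    (2 : ℝ) ^ (κ - q) ≤ run F.round G 0 N := by
  have hU : (2 : ℝ) ^ (κ - q) ∈ F.permissible := F.zpow_mem hκ (by omega)
  rcases hlt with hlt | ⟨rfl, hlt⟩
  · obtain ⟨l, rfl⟩ : ∃ l, N = m + 1 + l := ⟨N - (m + 1), by omega⟩
    rw [run_add]
    refine FPTransformer.le_run hU (run_mem F.zero_mem _) ?_
      fun i hi => hG.term_nonneg (by omega) (by omega)
    rw [run, hG.run_first hq hκ hκ2 hm, hG.head',
      F.add_eq (F.neg_mem (F.mant_mem f hq hκ hκ2)) (F.zpow_mem (by omega) hκ3)]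
    refine F.le_round hU ?_
    have h1 := mant_add_le κ f q
    have h2 : (2 : ℝ) ^ (κ + 1) ≤ (2 : ℝ) ^ κ' := zpow_le_zpow_right₀ (by norm_num) (by omega)
    linarith
  · obtain ⟨l, rfl⟩ := Nat.exists_eq_add_of_le hN
    rw [run_add]
    refine FPTransformer.le_run hU (run_mem F.zero_mem _) ?_
      fun i hi => hG.term_nonneg (by omega) (by omega)
    rw [hG.run_second hq hκ hκ2 hm rfl]
    have hv : ((2 ^ q + bitsVal f q : ℕ) : ℝ) + 1 ≤ ((2 ^ q + bitsVal f' q : ℕ) : ℝ) := by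
      exact_mod_cast (by omega)
    have : (0 : ℝ) < (2 : ℝ) ^ (κ - q) := by positivity
    rw [mant, mant]
    nlinarith

end NumeratorTerms

/-! ### A Transformer that tests a quotient for a given value. -/

/-- The Transformer whose attention weights are `w`, whose values are `v`, and whose MLP tests
whether its input is `2 ^ γ`, in a format with `M` bits of mantissa. -/
noncomputable def testTransformer (n : ℕ) {A : Type} (w v : ℕ → A → ℝ) (γ : ℤ) (M : ℕ) :
    Transformer (n + 1) A 3 1 1 2 where
  -- Query `1` and key `log w` give the exact score `log w`, so the exponential returns the
  -- permissible weight `w` without error.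
  embed j x := ![1, Real.log (w j x), v j x]
  WQ a _ := ![1, 0, 0] a
  WK a _ := ![0, 1, 0] a
  WV a _ := ![0, 0, 1] a
  w1 _ j := ![(2 : ℝ) ^ (-γ), -(2 : ℝ) ^ (-γ)] j
  b1 j := ![-1, 1] j
  -- A hidden node of size at least `2 ^ (-M)` becomes at most `-1` and outweighs the final bias
  -- `1`.
  w2 _ _ := -(2 : ℝ) ^ (M : ℤ)
  b2 _ := 1

section

variable {n : ℕ} {A : Type} {w v : ℕ → A → ℝ} {γ : ℤ} {F : Format}

theorem testTransformer_weight (hw : ∀ j x, 0 < w j x) (hw' : ∀ j x, w j x ∈ F.permissible)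
    (x : Fin (n + 1) → A) (i j : Fin (n + 1)) :
    (testTransformer n w v γ F.M).weight F id x i j = w j (x j) := by
  have hs : (testTransformer n w v γ F.M).score id x i j = Real.log (w j (x j)) := by
    simp [Transformer.score, testTransformer, dot, lsum_one, lsum_three, mul, add]
  rw [Transformer.weight, hs, Real.exp_log (hw _ _), F.round_eq_self (hw' _ _)]

theorem testTransformer_output (hw : ∀ j x, 0 < w j x) (hw' : ∀ j x, w j x ∈ F.permissible)
    (hv : ∀ j x, v j x ∈ F.permissible) (hwv : ∀ j x, w j x * v j x ∈ F.permissible)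
    (x : Fin (n + 1) → A) (i : Fin (n + 1)) (gn gd : ℕ → ℝ)
    (hgn : ∀ j : Fin (n + 1), w j (x j) * v j (x j) = gn j)
    (hgd : ∀ j : Fin (n + 1), w j (x j) = gd j) :
    (testTransformer n w v γ F.M).output F id x i = (testTransformer n w v γ F.M).mlp F
      (fun _ => F.round (run F.round gn 0 (n + 1) / run F.round gd 0 (n + 1))) := by
  refine Transformer.output_eq_run _ F id x i gn gd (fun j => ?_) fun j => ?_
  · rw [testTransformer_weight hw hw', ← hgn j, dot, lsum_three]
    have e1 : (testTransformer n w v γ F.M).WV 0 0 = 0 := rfl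
    have e2 : (testTransformer n w v γ F.M).WV 1 0 = 0 := rfl
    have e3 : (testTransformer n w v γ F.M).WV 2 0 = 1 := rfl
    have e4 : (testTransformer n w v γ F.M).embed j (x j) 2 = v j (x j) := rfl
    have hz : ∀ u, mul F.round u 0 = 0 := fun u => by simp [mul]
    have ha : add F.round 0 0 = 0 := by simp [add]
    have h3 := hwv j (x j)
    rw [e1, e2, e3, e4, hz, hz, ha, ha, F.mul_eq (hw' _ _) (hv _ _), F.round_eq_self h3,
      F.mul_eq h3 F.one_mem, mul_one, F.round_eq_self h3,
      F.add_exact F.zero_mem h3 (by rwa [zero_add]), zero_add]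
  · rw [testTransformer_weight hw hw', ← hgd j]

/-- The value of a hidden node. -/
theorem testTransformer_hidden {R ω b : ℝ} (hR : R ∈ F.permissible) (hω : ω ∈ F.permissible)
    (hb : b ∈ F.permissible) :
    add F.round (dot F.round (fun _ : Fin 1 => R) (fun _ => ω)) b =
      F.round (F.round (R * ω) + b) := by
  have h := F.round_mem (R * ω)
  rw [dot, lsum_one, F.mul_eq hR hω, F.add_exact F.zero_mem h (by rwa [zero_add]), zero_add,
    F.add_eq h hb]

theorem testTransformer_mlp (hγ : -γ ≤ F.emax) (hγ' : 0 ≤ -γ) (hM : (F.M : ℤ) ≤ F.emax) {R : ℝ}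
    (hR : R ∈ F.permissible) (k : Fin 3) :
    (testTransformer n w v γ F.M).mlp F (fun _ => R) k =
      max 0 (F.round (F.round (
        F.round (max 0 (F.round (F.round (R * (2 : ℝ) ^ (-γ)) + -1)) * -(2 : ℝ) ^ (F.M : ℤ)) +
        F.round (max 0 (F.round (F.round (R * -(2 : ℝ) ^ (-γ)) + 1)) * -(2 : ℝ) ^ (F.M : ℤ)))
          + 1)) := by
  have hE := F.emax_nonneg
  have h1 : (2 : ℝ) ^ (-γ) ∈ F.permissible := F.zpow_mem (by omega) hγ
  have h2 : -(2 : ℝ) ^ (F.M : ℤ) ∈ F.permissible := F.neg_mem (F.zpow_mem (by omega) hM)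
  have hmax : ∀ u, max 0 (F.round u) ∈ F.permissible := by
    intro u
    rcases max_choice 0 (F.round u) with h | h <;> rw [h]
    · exact F.zero_mem
    · exact F.round_mem u
  rw [Transformer.mlp, dot, lsum_two]
  have e1 : (fun c : Fin 1 => (testTransformer n w v γ F.M).w1 c 0) =
      fun _ => (2 : ℝ) ^ (-γ) := rfl
  have e2 : (fun c : Fin 1 => (testTransformer n w v γ F.M).w1 c 1) =
      fun _ => -(2 : ℝ) ^ (-γ) := rfl
  have e3 : (testTransformer n w v γ F.M).b1 0 = -1 := rfl
  have e4 : (testTransformer n w v γ F.M).b1 1 = 1 := rfl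
  have e5 : ∀ j, (testTransformer n w v γ F.M).w2 j k = -(2 : ℝ) ^ (F.M : ℤ) := fun _ => rfl
  have e6 : (testTransformer n w v γ F.M).b2 k = 1 := rfl
  simp only [e1, e2, e3, e4, e5, e6]
  rw [testTransformer_hidden hR h1 (F.neg_mem F.one_mem),
    testTransformer_hidden hR (F.neg_mem h1) F.one_mem, F.mul_eq (hmax _) h2,
    F.mul_eq (hmax _) h2, F.add_exact F.zero_mem (F.round_mem _)
      (by rw [zero_add]; exact F.round_mem _), zero_add,
    F.add_eq (F.round_mem _) (F.round_mem _), F.add_eq (F.round_mem _) F.one_mem]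

theorem testTransformer_mlp_eq_one (hγ : -γ ≤ F.emax) (hγ' : 0 ≤ -γ) (hM : (F.M : ℤ) ≤ F.emax)
    (k : Fin 3) : (testTransformer n w v γ F.M).mlp F (fun _ => (2 : ℝ) ^ γ) k = 1 := by
  have hR : (2 : ℝ) ^ γ ∈ F.permissible := F.zpow_mem (by omega) (by have := F.emax_nonneg; omega)
  have e : (2 : ℝ) ^ γ * (2 : ℝ) ^ (-γ) = 1 := by
    rw [← zpow_add₀ (by norm_num), add_neg_cancel, zpow_zero]
  rw [testTransformer_mlp hγ hγ' hM hR, mul_neg ((2 : ℝ) ^ γ), e, F.round_eq_self F.one_mem,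
    F.round_eq_self (F.neg_mem F.one_mem)]
  simp [F.round_eq_self F.one_mem]

theorem testTransformer_mlp_eq_zero (hγ : -γ ≤ F.emax) (hγ' : 0 ≤ -γ) (hM : (F.M : ℤ) ≤ F.emax)
    (hM0 : 0 < F.M) {R : ℝ} (hR : R ∈ F.permissible)
    (h : (2 : ℝ) ^ γ * (1 + (2 : ℝ) ^ (-(F.M : ℤ))) ≤ R ∨
      R ≤ (2 : ℝ) ^ γ * (1 - (2 : ℝ) ^ (-(F.M : ℤ)))) (k : Fin 3) :
    (testTransformer n w v γ F.M).mlp F (fun _ => R) k = 0 := by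
  have hE := F.emax_nonneg
  have hu : (2 : ℝ) ^ (-(F.M : ℤ)) ∈ F.permissible := F.zpow_mem (by omega) (by omega)
  have hc : (2 : ℝ) ^ γ * (2 : ℝ) ^ (-γ) = 1 := by
    rw [← zpow_add₀ (by norm_num), add_neg_cancel, zpow_zero]
  have hc0 : (0 : ℝ) < (2 : ℝ) ^ (-γ) := by positivity
  have hMM : (2 : ℝ) ^ (-(F.M : ℤ)) * (2 : ℝ) ^ (F.M : ℤ) = 1 := by
    rw [← zpow_add₀ (by norm_num), neg_add_cancel, zpow_zero]
  have hM1 : (0 : ℝ) < (2 : ℝ) ^ (F.M : ℤ) := by positivity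
  have hn1 : (-1 : ℝ) ∈ F.permissible := F.neg_mem F.one_mem
  -- a hidden node contributes at most `0`, and at most `-1` if it is active
  have hle : ∀ u, F.round (max 0 (F.round u) * -(2 : ℝ) ^ (F.M : ℤ)) ≤ 0 := by
    intro u
    refine F.round_nonpos ?_
    have : 0 ≤ max 0 (F.round u) * (2 : ℝ) ^ (F.M : ℤ) := by positivity
    linarith
  have hle1 : ∀ u, (2 : ℝ) ^ (-(F.M : ℤ)) ≤ u →
      F.round (max 0 (F.round u) * -(2 : ℝ) ^ (F.M : ℤ)) ≤ -1 := by
    intro u h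
    refine F.round_le hn1 ?_
    have h1 : (2 : ℝ) ^ (-(F.M : ℤ)) ≤ max 0 (F.round u) := le_max_of_le_right (F.le_round hu h)
    have h2 := mul_le_mul_of_nonneg_right h1 hM1.le
    linarith
  have hlast : ∀ a b : ℝ, a + b ≤ -1 → max 0 (F.round (F.round (a + b) + 1)) = 0 := by
    intro a b h
    have h1 := F.round_le hn1 h
    exact max_eq_left (F.round_nonpos (by linarith))
  rw [testTransformer_mlp hγ hγ' hM hR]
  apply hlast
  -- A quotient that is too large activates the first hidden node, one that is too small the second;
  -- the other node can only lower the sum.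
  rcases h with h | h
  · have h1 : 1 + (2 : ℝ) ^ (-(F.M : ℤ)) ≤ R * (2 : ℝ) ^ (-γ) := by
      have := mul_le_mul_of_nonneg_right h hc0.le
      rwa [mul_right_comm, hc, one_mul] at this
    have hmem : 1 + (2 : ℝ) ^ (-(F.M : ℤ)) ∈ F.permissible := by
      have := F.natCast_mul_zpow_mem (q := F.M) (n := 2 ^ F.M + 1) (k := -F.M) le_rfl
        (by have : 1 < 2 ^ F.M := Nat.one_lt_two_pow (by omega)
            rw [pow_succ]; omega) (by omega) (by omega)
      push_cast at this
      rwa [add_mul, one_mul, ← zpow_natCast, mul_comm ((2 : ℝ) ^ (F.M : ℤ)), hMM] at this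
    have h2 := hle1 (F.round (R * (2 : ℝ) ^ (-γ)) + -1) (by linarith [F.le_round hmem h1])
    linarith [hle (F.round (R * -(2 : ℝ) ^ (-γ)) + 1)]
  · have h1 : R * -(2 : ℝ) ^ (-γ) ≥ -(1 - (2 : ℝ) ^ (-(F.M : ℤ))) := by
      have := mul_le_mul_of_nonneg_right h hc0.le
      rw [mul_right_comm, hc, one_mul] at this
      linarith
    have hmem : 1 - (2 : ℝ) ^ (-(F.M : ℤ)) ∈ F.permissible := by
      have := F.intCast_mul_zpow_mem (q := F.M) (n := 2 ^ F.M - 1) (k := -F.M) le_rfl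
        (by have : (1 : ℤ) ≤ 2 ^ F.M := one_le_pow₀ (by norm_num)
            rw [pow_succ, abs_lt]; omega) (by omega) (by omega)
      push_cast at this
      rwa [sub_mul, one_mul, ← zpow_natCast, mul_comm ((2 : ℝ) ^ (F.M : ℤ)), hMM] at this
    have h2 := hle1 (F.round (R * -(2 : ℝ) ^ (-γ)) + 1)
      (by linarith [F.le_round (F.neg_mem hmem) h1])
    linarith [hle (F.round (R * (2 : ℝ) ^ (-γ)) + -1)]

end

/-! ### Encoding the halves in weights and values. -/

/-- The number whose binary expression is given by the first `l` bits of the tuple `u`. -/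
def code {k : ℕ} (u : Fin k → Bool) (l : ℕ) : ℕ :=
  bitsVal (fun i => if h : i < k then u ⟨i, h⟩ else false) l

/-- The attention weights: `2 ^ A` except at the tokens of `y` that hold the lower half, where the
weights sum up to a number with exponent `β + code`. -/
noncomputable def eqWeight (t L : ℕ) (A β : ℤ) {e : ℕ} (j : ℕ) (x : Token e) : ℝ :=
  -- `mant _ f 1` reads only `f 0`, hence the constant function: leading one and first fraction bit
  -- share this token.
  if j = t then mant (β + code x.1 (e - L)) (fun _ => x.2) 1
  else if t < j ∧ j < t + (t - 2) ∧ x.2 = true then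
    (2 : ℝ) ^ (β + code x.1 (e - L) - (j - t + 1 : ℕ))
  -- An exponential cannot vanish, so zero bits too get the small weight that rounding absorbs.
  else (2 : ℝ) ^ A

/-- The values: the upper half of `y` with negative sign, the upper half of `z`, and the lower half
of `z` with exponent `μ + code`. -/
noncomputable def eqValue (m t L : ℕ) (μ : ℤ) {e : ℕ} (j : ℕ) (x : Token e) : ℝ :=
  if j = 0 then -(2 : ℝ) ^ (code x.1 (e - 1) : ℤ)
  else if j < t then -if x.2 then (2 : ℝ) ^ ((code x.1 (e - 1) : ℤ) - j) else 0
  else if j < m then 0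
  else if j = m then (2 : ℝ) ^ (code x.1 (e - 1) : ℤ)
  else if j < m + t then if x.2 then (2 : ℝ) ^ ((code x.1 (e - 1) : ℤ) - (j - m : ℕ)) else 0
  else if j = m + t then mant (μ + code x.1 (e - L)) (fun _ => x.2) 1
  else if j < m + t + (t - 2) then
    if x.2 then (2 : ℝ) ^ (μ + code x.1 (e - L) - (j - (m + t) + 1 : ℕ)) else 0
  else 0

theorem code_lt {k : ℕ} (u : Fin k → Bool) (l : ℕ) : code u l < 2 ^ l := bitsVal_lt _ _

theorem eqWeight_pos (t L : ℕ) (A β : ℤ) {e : ℕ} (j : ℕ) (x : Token e) :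
    0 < eqWeight t L A β j x := by
  unfold eqWeight
  split_ifs
  · exact mant_pos _ _ _
  · positivity
  · positivity

theorem eqWeight_eq {t L : ℕ} {A β : ℤ} {e j : ℕ} (x : Token e) (ht : 2 < t)
    (h : j < t ∨ t + (t - 2) ≤ j) : eqWeight t L A β j x = (2 : ℝ) ^ A := by
  rw [eqWeight, if_neg (by omega), if_neg (by omega)]

section

variable {F : Format} {m t L e : ℕ} {A β μ : ℤ}

theorem eqWeight_mem (hM : 0 < F.M) (hA : -F.emax ≤ A) (hA' : A ≤ F.emax)
    (hβ : -F.emax ≤ β - t) (hβ' : β + 2 ^ (e - L) ≤ F.emax) (ht : 0 < t) (j : ℕ) (x : Token e) :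
    eqWeight t L A β j x ∈ F.permissible := by
  have hc : (code x.1 (e - L) : ℤ) < 2 ^ (e - L) := by exact_mod_cast code_lt x.1 (e - L)
  unfold eqWeight
  split_ifs with h1 h2
  · exact F.mant_mem _ hM (by omega) (by omega)
  · exact F.zpow_mem (by push_cast; omega) (by push_cast; omega)
  · exact F.zpow_mem hA hA'

/-- Used with `s = 0` for the stored value and with `s = A` for its product with the weight. -/
theorem zpow_mul_eqValue_mem {s : ℤ} (hM : 0 < F.M) (hs : -F.emax ≤ s - t) (hs0 : s ≤ 0)
    (he : (2 : ℤ) ^ (e - 1) ≤ F.emax + 1) (ht : 2 < t) (hμ : -F.emax ≤ s + μ - (t - 2 : ℕ))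
    (hμ' : μ + 2 ^ (e - L) ≤ F.emax) (j : ℕ) (x : Token e) :
    (2 : ℝ) ^ s * eqValue m t L μ j x ∈ F.permissible := by
  have hc : (code x.1 (e - L) : ℤ) < 2 ^ (e - L) := by exact_mod_cast code_lt x.1 (e - L)
  have hc' : (code x.1 (e - 1) : ℤ) < 2 ^ (e - 1) := by exact_mod_cast code_lt x.1 (e - 1)
  have hpow : ∀ k : ℤ, -F.emax ≤ s + k → s + k ≤ F.emax →
      (2 : ℝ) ^ s * (2 : ℝ) ^ k ∈ F.permissible := by
    intro k h1 h2
    rw [← zpow_add₀ (by norm_num)]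
    exact F.zpow_mem h1 h2
  have hz : (2 : ℝ) ^ s * 0 ∈ F.permissible := by rw [mul_zero]; exact F.zero_mem
  unfold eqValue
  split_ifs with h1 h2 h3 h4 h5 h6 h7 h8 h9 h10
  · rw [mul_neg]; exact F.neg_mem (hpow _ (by omega) (by omega))
  · rw [mul_neg]; exact F.neg_mem (hpow _ (by omega) (by omega))
  · rw [neg_zero]; exact hz
  · exact hz
  · exact hpow _ (by omega) (by omega)
  · exact hpow _ (by omega) (by omega)
  · exact hz
  · rw [zpow_mul_mant]; exact F.mant_mem _ hM (by push_cast; omega) (by omega)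
  · exact hpow _ (by omega) (by omega)
  · exact hz
  · exact hz

end

/-- The exponent of the upper half of a string. -/
def upperExp {m : ℕ} (e : ℕ) (y : Fin m → Bool) : ℕ := bitsVal (fun i => bit y (i + 1)) (e - 1)

/-- The fraction of the upper half of a string. -/
def upperFrac {m : ℕ} (e : ℕ) (y : Fin m → Bool) (i : ℕ) : Bool := bit y (e + i)

/-- The exponent of the lower half of a string. -/
def lowerExp {m : ℕ} (t e : ℕ) (y : Fin m → Bool) : ℕ :=
  bitsVal (fun i => bit y (t + e - 1 + i)) (e - lg m)

/-- The fraction of the lower half of a string. -/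
def lowerFrac {m : ℕ} (t e : ℕ) (y : Fin m → Bool) (i : ℕ) : Bool :=
  bit y (t + 2 * e - 1 - lg m + i)

theorem code_tuple₁ {m : ℕ} (e : ℕ) (y : Fin m → Bool) :
    code (tuple₁ e y) (e - 1) = upperExp e y :=
  bitsVal_congr fun i hi => by simp [hi, tuple₁]

theorem code_tuple₂ {m : ℕ} {t e : ℕ} (y : Fin m → Bool) (hL : 0 < lg m) :
    code (tuple₂ t e y) (e - lg m) = lowerExp t e y :=
  bitsVal_congr fun i hi => by
    have : i < e - 1 := by omega
    simp [hi, this, tuple₂]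

/-- The two halves determine the string. -/
theorem eq_of_halves_eq {m t e : ℕ} {y z : Fin m → Bool} (ht : 2 < t)
    (hL : lg m + 2 < e) (hm : m + lg m + 4 ≤ 2 * (t + e))
    (h1 : upperExp e y = upperExp e z)
    (h2 : bitsVal (upperFrac e y) (t - 1) = bitsVal (upperFrac e z) (t - 1))
    (h3 : lowerExp t e y = lowerExp t e z)
    (h4 : bitsVal (lowerFrac t e y) (t - 2) = bitsVal (lowerFrac t e z) (t - 2)) : y = z := by
  have g1 := eq_of_bitsVal_eq h1
  have g2 := eq_of_bitsVal_eq h2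
  have g3 := eq_of_bitsVal_eq h3
  have g4 := eq_of_bitsVal_eq h4
  -- The four blocks have `e - 1`, `t - 1`, `e - lg m` and `t - 2` bits; by `hm` they reach the last
  -- bit `m`.
  have key : ∀ i, 1 ≤ i → i ≤ m → bit y i = bit z i := by
    intro i hi1 him
    rcases Nat.lt_or_ge i e with h | h
    · have := g1 (i - 1) (by omega)
      simpa [Nat.sub_add_cancel hi1] using this
    rcases Nat.lt_or_ge i (t + e - 1) with h' | h'
    · have := g2 (i - e) (by omega)
      simpa [upperFrac, Nat.add_sub_cancel' h] using this
    rcases Nat.lt_or_ge i (t + 2 * e - 1 - lg m) with h'' | h''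
    · have := g3 (i - (t + e - 1)) (by omega)
      simpa [Nat.add_sub_cancel' h'] using this
    · have := g4 (i - (t + 2 * e - 1 - lg m)) (by omega)
      simpa [lowerFrac, Nat.add_sub_cancel' h''] using this
  funext i
  have := key (i + 1) (by omega) (by omega)
  have hi : (i : ℕ) + 1 ≤ m := i.2
  simpa [bit, hi] using this

/-- The order of binary numbers in terms of the upper halves. -/
theorem upper_lt_or_of_le {m t e : ℕ} {y z : Fin m → Bool} (he : 0 < e) (ht : 0 < t)
    (hm : t + e ≤ m + 2) (h : binVal y ≤ binVal z) :
    upperExp e y < upperExp e z ∨ upperExp e y = upperExp e z ∧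
      bitsVal (upperFrac e y) (t - 1) ≤ bitsVal (upperFrac e z) (t - 1) := by
  rw [binVal_eq_bitsVal, binVal_eq_bitsVal] at h
  obtain ⟨r, hr⟩ : ∃ r, m = e - 1 + (t - 1) + r := ⟨m - (e - 1 + (t - 1)), by omega⟩
  have h' : bitsVal (fun i => bit y (i + 1)) (e - 1 + (t - 1) + r) ≤
      bitsVal (fun i => bit z (i + 1)) (e - 1 + (t - 1) + r) := by
    rw [← hr]; exact h
  have := bitsVal_lt_or_of_le h'
  have hf : ∀ w : Fin m → Bool, (fun i => bit w (e - 1 + i + 1)) = upperFrac e w := by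
    intro w; funext i; rw [upperFrac]; congr 1; omega
  rwa [hf, hf] at this

/-! ### From the input representation to the accumulators. -/

/-- The tokens of the input, indexed by natural numbers. -/
def tokenAt {m : ℕ} (n t e : ℕ) (y z : Fin m → Bool) (j : ℕ) : Token e :=
  if h : j < n + 1 then tokens n t e y z ⟨j, h⟩ else zeroToken e

section

variable {m n t e : ℕ} (y z : Fin m → Bool)

theorem tokenAt_eq {j : ℕ} (h : j < n) :
    tokenAt n t e y z j = inputRep n t e y z ⟨j, h⟩ := by
  rw [tokenAt, dif_pos (by omega), tokens_of_lt]

theorem tokenAt_zero (h : 0 < n) : tokenAt n t e y z 0 = (tuple₁ e y, false) := by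
  rw [tokenAt_eq y z h]; rfl

theorem tokenAt_upper {i : ℕ} (hi : i + 1 < t) (h : i + 1 < n) :
    tokenAt n t e y z (i + 1) = (tuple₁ e y, upperFrac e y i) := by
  rw [tokenAt_eq y z h, inputRep, if_neg (by simp), if_pos (by simp only []; omega), upperFrac]
  rfl

theorem tokenAt_lower {i : ℕ} (hL : lg m + 2 < e) (hi : i + 1 < t) (h : t + i < n) :
    tokenAt n t e y z (t + i) = (tuple₂ t e y, lowerFrac t e y i) := by
  rw [tokenAt_eq y z h, inputRep, if_neg (by simp only []; omega), if_neg (by simp only []; omega),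
    if_pos (by simp only []; omega), lowerFrac]
  congr 2
  simp only []; omega

theorem tokenAt_second (ht : 0 < t) (hm : 2 * t ≤ m) (h : m < n) :
    tokenAt n t e y z m = (tuple₁ e z, false) := by
  rw [tokenAt_eq y z h, inputRep, if_neg (by simp only []; omega), if_neg (by simp only []; omega),
    if_neg (by simp only []; omega), if_neg (by simp only []; omega),
    if_neg (by simp only []; omega), if_pos rfl]

theorem tokenAt_second_upper (hm : 2 * t ≤ m) {i : ℕ} (hi : i + 1 < t) (h : m + (i + 1) < n) :
    tokenAt n t e y z (m + (i + 1)) = (tuple₁ e z, upperFrac e z i) := by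
  rw [tokenAt_eq y z h, inputRep, if_neg (by simp only []; omega), if_neg (by simp only []; omega),
    if_neg (by simp only []; omega), if_neg (by simp only []; omega),
    if_neg (by simp only []; omega), if_neg (by simp only []; omega),
    if_pos (by simp only []; omega), upperFrac]
  congr 2
  simp only []; omega

theorem tokenAt_second_lower (hm : 2 * t ≤ m) (hL : lg m + 2 < e) {i : ℕ} (hi : i + 1 < t)
    (h : m + t + i < n) : tokenAt n t e y z (m + t + i) = (tuple₂ t e z, lowerFrac t e z i) := by
  rw [tokenAt_eq y z h, inputRep, if_neg (by simp only []; omega), if_neg (by simp only []; omega),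
    if_neg (by simp only []; omega), if_neg (by simp only []; omega),
    if_neg (by simp only []; omega), if_neg (by simp only []; omega),
    if_neg (by simp only []; omega), if_pos (by simp only []; omega), lowerFrac]
  congr 2
  simp only []; omega

end

section

variable {F : Format} {m n t e : ℕ} {A β μ : ℤ} (y z : Fin m → Bool)

/-- The denominator is the lower half of `y`. -/
theorem run_eqWeight (ht : 2 < t) (hM : t - 2 ≤ F.M) (hm : 2 * t ≤ m) (hmn : 2 * m ≤ n)
    (hL0 : 0 < lg m) (hL : lg m + 2 < e) (hA : -F.emax ≤ A) (hβ : A + t ≤ β - F.M - 1)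
    (hβ' : β + 2 ^ (e - lg m) ≤ F.emax) :
    run F.round (fun j => eqWeight t (lg m) A β j (tokenAt n t e y z j)) 0 (n + 1) =
      mant (β + lowerExp t e y) (lowerFrac t e y) (t - 2) := by
  have hc : (lowerExp t e y : ℤ) < 2 ^ (e - lg m) := by exact_mod_cast bitsVal_lt _ (e - lg m)
  refine run_denominator (A := A) (t := t) (by omega) hM hA (by omega) (by omega) (by omega)
    (by omega) (fun i hi => eqWeight_eq _ ht (Or.inl hi)) ?_ ?_
    fun j hj _ => eqWeight_eq _ ht (Or.inr hj)
  · have h := tokenAt_lower y z (n := n) (t := t) (e := e) (i := 0) hL (by omega) (by omega)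
    rw [Nat.add_zero] at h
    rw [eqWeight, if_pos rfl, h, code_tuple₂ y hL0]
    exact mant_congr rfl (bitsVal_congr fun i hi => by rw [Nat.lt_one_iff.mp hi])
  · intro i hi hi'
    rw [eqWeight, if_neg (by omega), tokenAt_lower y z hL (by omega) (by omega),
      code_tuple₂ y hL0, Nat.add_sub_cancel_left]
    refine if_congr ?_ rfl rfl
    constructor
    · exact fun h => h.2.2
    · exact fun h => ⟨by omega, by omega, h⟩

/-- The numerator sums up the upper halves, with opposite signs, and the lower half of `z`. -/
theorem numeratorTerms_eqValue (ht : 2 < t) (hm : 2 * t ≤ m) (hmn : 2 * m ≤ n)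
    (hL0 : 0 < lg m) (hL : lg m + 2 < e) :
    NumeratorTerms (fun j => eqWeight t (lg m) A β j (tokenAt n t e y z j) *
        eqValue m t (lg m) μ j (tokenAt n t e y z j))
      (A + upperExp e y) (A + upperExp e z) (A + (μ + lowerExp t e z)) (upperFrac e y)
      (upperFrac e z) (lowerFrac t e z) (t - 1) (t - 2) m (n + 1) where
  head := by
    rw [eqWeight_eq _ ht (by omega), tokenAt_zero y z (by omega), eqValue, if_pos rfl,
      code_tuple₁, zpow_add₀ (by norm_num), mul_neg]
  frac := fun i hi => by
    rw [eqWeight_eq _ ht (by omega), tokenAt_upper y z (by omega) (by omega), eqValue,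
      if_neg (by omega), if_pos (by omega), code_tuple₁, mul_neg, mul_ite, mul_zero,
      ← zpow_add₀ (by norm_num), add_sub_assoc]
  gap := fun j hj hjm => by
    rw [eqValue, if_neg (by omega), if_neg (by omega), if_pos hjm, mul_zero]
  head' := by
    rw [eqWeight_eq _ ht (by omega), tokenAt_second y z (by omega) hm (by omega), eqValue,
      if_neg (by omega), if_neg (by omega), if_neg (by omega), if_pos rfl,
      code_tuple₁, zpow_add₀ (by norm_num)]
  frac' := fun i hi => by
    rw [eqWeight_eq _ ht (by omega), tokenAt_second_upper y z hm (by omega) (by omega), eqValue,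
      if_neg (by omega), if_neg (by omega), if_neg (by omega), if_neg (by omega),
      if_pos (by omega), code_tuple₁, mul_ite, mul_zero, ← zpow_add₀ (by norm_num),
      add_sub_assoc, Nat.add_sub_cancel_left]
  low := by
    have h := tokenAt_second_lower y z (n := n) (t := t) (e := e) (i := 0) hm hL (by omega)
      (by omega)
    rw [Nat.add_zero] at h
    rw [show m + (t - 1 + 1) = m + t by omega, eqWeight_eq _ ht (by omega), h, eqValue,
      if_neg (by omega), if_neg (by omega), if_neg (by omega), if_neg (by omega),
      if_neg (by omega), if_pos rfl, code_tuple₂ z hL0, zpow_mul_mant]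
    exact mant_congr rfl (bitsVal_congr fun i hi => by rw [Nat.lt_one_iff.mp hi])
  lowFrac := fun i hi hi' => by
    rw [show m + (t - 1 + 1) + i = m + t + i by omega, eqWeight_eq _ ht (by omega),
      tokenAt_second_lower y z hm hL (by omega) (by omega), eqValue, if_neg (by omega),
      if_neg (by omega), if_neg (by omega), if_neg (by omega), if_neg (by omega),
      if_neg (by omega), if_pos (by omega), code_tuple₂ z hL0, mul_ite, mul_zero,
      ← zpow_add₀ (by norm_num), add_sub_assoc A, Nat.add_sub_cancel_left]
  tail := fun j hj _ => by
    rw [eqValue, if_neg (by omega), if_neg (by omega), if_neg (by omega), if_neg (by omega),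
      if_neg (by omega), if_neg (by omega), if_neg (by omega), mul_zero]

end

/-! ### Choice of the exponents and conclusion. -/

namespace Format

variable (F : Format)

/-- A permissible threshold next to `2 ^ γ`, which the rounding of the quotient therefore cannot
cross. -/
theorem zpow_mul_one_add_mem {γ : ℤ} (hM : 0 < F.M) (h1 : -F.emax ≤ γ) (h2 : γ ≤ F.emax) :
    (2 : ℝ) ^ γ * (1 + (2 : ℝ) ^ (-(F.M : ℤ))) ∈ F.permissible := by
  have h : 1 < 2 ^ F.M := Nat.one_lt_two_pow (by omega)
  have := F.normalized_mem (n := 2 ^ F.M + 1) (k := γ - F.M) (by omega) (by rw [pow_succ]; omega)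
    (by omega) (by omega)
  convert this using 1
  push_cast
  rw [zpow_sub₀ (by norm_num), zpow_neg, zpow_natCast]
  field_simp

theorem zpow_mul_one_sub_mem {γ : ℤ} (hM : 0 < F.M) (h1 : -F.emax ≤ γ - 1) (h2 : γ ≤ F.emax) :
    (2 : ℝ) ^ γ * (1 - (2 : ℝ) ^ (-(F.M : ℤ))) ∈ F.permissible := by
  have h : 1 < 2 ^ F.M := Nat.one_lt_two_pow (by omega)
  have := F.normalized_mem (n := (2 ^ F.M - 1) * 2) (k := γ - 1 - F.M) (by omega)
    (by rw [pow_succ]; omega) (by omega) (by omega)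
  convert this using 1
  push_cast [Nat.cast_sub h.le]
  rw [zpow_sub₀ (by norm_num), zpow_sub₀ (by norm_num), zpow_neg, zpow_natCast, zpow_one]
  field_simp

end Format

/-- A format with `M ≥ t - 1` bits of mantissa and a sufficiently large range of exponents computes
equality. -/
theorem computesEQ_testTransformer {F : Format} {m n t e : ℕ} (ht : 2 < t) (htM : t ≤ F.M + 1)
    (hL0 : 0 < lg m) (hL : lg m + 2 < e) (hmt : 2 * t ≤ m) (hmte : t + e ≤ m + 2)
    (hmL : m + lg m + 4 ≤ 2 * (t + e)) (hmn : 2 * m ≤ n)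
    (he : (2 : ℤ) ^ (e - 1) ≤ F.emax + 1) (hE : 3 * F.M + 2 ^ (e - lg m) + 4 ≤ F.emax)
    {A β μ γ : ℤ} (hA : A = 2 * F.M + 2 ^ (e - lg m) - F.emax) (hβ : β = A + 2 * F.M + 2)
    (hγ : γ = -(3 * F.M + 2 ^ (e - lg m) + 3)) (hμ : μ = β + γ - A) :
    ComputesEQ m n t e (by norm_num)
      (testTransformer n (eqWeight t (lg m) A β) (eqValue m t (lg m) μ) γ F.M) F id := by
  -- `β` lies above `A` far enough that up to `2 ^ (A + t)` is absorbed, as `t ≤ M + 1`. `γ` puts `2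
  -- ^ (γ + 1)` times the largest denominator below the least difference of upper halves. `μ` makes
  -- the lower half of `z` appear with exponent `γ + β`, and `A` keeps its last bit at or above `2 ^
  -- (-emax)`.
  rintro y z ⟨hyz, -⟩
  have hK : (0 : ℤ) < 2 ^ (e - lg m) := by positivity
  set K : ℤ := 2 ^ (e - lg m) with hKdef
  have hM0 : 0 < F.M := by omega
  have hwmem : ∀ j (x : Token e), eqWeight t (lg m) A β j x ∈ F.permissible :=
    eqWeight_mem hM0 (by omega) (by omega) (by omega) (by omega) (by omega)
  have hvmem : ∀ s : ℤ, A ≤ s → s ≤ 0 → ∀ j (x : Token e),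
      (2 : ℝ) ^ s * eqValue m t (lg m) μ j x ∈ F.permissible := fun s h1 h2 =>
    zpow_mul_eqValue_mem hM0 (by omega) h2 he ht (by omega) (by omega)
  have hout := testTransformer_output (n := n) (γ := γ) (F := F)
    (w := eqWeight (e := e) t (lg m) A β) (v := eqValue (e := e) m t (lg m) μ)
    (eqWeight_pos _ _ _ _) hwmem (fun j x => by simpa using hvmem 0 (by omega) le_rfl j x)
    (fun j x => by
      -- Where the weight is not `2 ^ A` the value is zero, so the lower half of `y` enters the
      -- denominator alone.
      by_cases hj : j < t ∨ t + (t - 2) ≤ j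
      · rw [eqWeight_eq x ht hj]; exact hvmem A le_rfl (by omega) j x
      · rw [eqValue, if_neg (by omega), if_neg (by omega), if_pos (by omega), mul_zero]
        exact F.zero_mem)
    (tokens n t e y z) (Fin.last n)
    (fun j => eqWeight t (lg m) A β j (tokenAt n t e y z j) *
      eqValue m t (lg m) μ j (tokenAt n t e y z j))
    (fun j => eqWeight t (lg m) A β j (tokenAt n t e y z j))
    (fun j => by simp only [tokenAt, j.2, dif_pos]) (fun j => by simp only [tokenAt, j.2, dif_pos])
  rw [run_eqWeight y z ht (by omega) hmt hmn hL0 hL (by omega) (by omega)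
    (by omega)] at hout
  have hG := numeratorTerms_eqValue (A := A) (β := β) (μ := μ) (e := e) y z ht hmt hmn hL0 hL
  have hay : (upperExp e y : ℤ) < 2 ^ (e - 1) := by exact_mod_cast bitsVal_lt _ (e - 1)
  have haz : (upperExp e z : ℤ) < 2 ^ (e - 1) := by exact_mod_cast bitsVal_lt _ (e - 1)
  have hby : (lowerExp t e y : ℤ) < K := by
    rw [hKdef]; exact_mod_cast bitsVal_lt _ (e - lg m)
  have hbz : (lowerExp t e z : ℤ) < K := by
    rw [hKdef]; exact_mod_cast bitsVal_lt _ (e - lg m)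
  change (testTransformer n (eqWeight t (lg m) A β) (eqValue m t (lg m) μ) γ F.M).output F id
    (tokens n t e y z) (Fin.last n) ⟨0, by norm_num⟩ = _
  rw [hout]
  set D : ℝ := mant (β + lowerExp t e y) (lowerFrac t e y) (t - 2) with hD
  have hD0 : 0 < D := mant_pos _ _ _
  have hc0 : (0 : ℝ) < (2 : ℝ) ^ γ := by positivity
  have hup := F.zpow_mul_one_add_mem (γ := γ) hM0 (by omega) (by omega)
  have hdown := F.zpow_mul_one_sub_mem (γ := γ) hM0 (by omega) (by omega)
  have hzero : ∀ N : ℝ, (2 : ℝ) ^ γ * (1 + (2 : ℝ) ^ (-(F.M : ℤ))) * D ≤ N ∨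
      N ≤ (2 : ℝ) ^ γ * (1 - (2 : ℝ) ^ (-(F.M : ℤ))) * D →
      (testTransformer n (eqWeight (e := e) t (lg m) A β) (eqValue m t (lg m) μ) γ F.M).mlp F
        (fun _ => F.round (N / D)) ⟨0, by norm_num⟩ = 0 := by
    intro N h
    refine testTransformer_mlp_eq_zero (by omega) (by omega) (by omega) hM0 (F.round_mem _) ?_ _
    rcases h with h | h
    · exact Or.inl (F.le_round hup ((le_div_iff₀ hD0).mpr h))
    · exact Or.inr (F.round_le hdown ((div_le_iff₀ hD0).mpr h))
  by_cases hupper : upperExp e y = upperExp e z ∧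
      bitsVal (upperFrac e y) (t - 1) = bitsVal (upperFrac e z) (t - 1)
  · rw [hG.run_eq (F := F) (by omega) (by omega) (by omega) (by omega) (by omega) (by omega)
      (by omega) (by omega) (by omega) (by omega) hupper.2]
    have hN : mant (A + (μ + lowerExp t e z)) (lowerFrac t e z) (t - 2) =
        (2 : ℝ) ^ γ * mant (β + lowerExp t e z) (lowerFrac t e z) (t - 2) := by
      rw [zpow_mul_mant]; congr 1; omega
    rw [hN]
    by_cases hlower : lowerExp t e y = lowerExp t e z ∧
        bitsVal (lowerFrac t e y) (t - 2) = bitsVal (lowerFrac t e z) (t - 2)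
    · have hyz : y = z := eq_of_halves_eq ht hL hmL hupper.1 hupper.2 hlower.1 hlower.2
      rw [if_pos hyz, ← mant_congr (κ := β + lowerExp t e y) (by rw [hlower.1]) hlower.2, ← hD,
        mul_div_cancel_right₀ _ hD0.ne', F.round_eq_self (F.zpow_mem (by omega) (by omega))]
      exact testTransformer_mlp_eq_one (by omega) (by omega) (by omega) _
    · have hne : y ≠ z := by rintro rfl; exact hlower ⟨rfl, rfl⟩
      rw [if_neg hne]
      apply hzero
      -- Fractions of only `t - 2` bits give a relative gap `2 ^ (-(t - 1))`, which `M ≥ t - 1` bits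
      -- resolve.
      have hu : (2 : ℝ) ^ (-(F.M : ℤ)) ≤ (2 : ℝ) ^ (-((t - 2 : ℕ) + 1 : ℤ)) :=
        zpow_le_zpow_right₀ (by norm_num) (by omega)
      have hcases : (β + (lowerExp t e y : ℤ) < β + lowerExp t e z ∨
          β + (lowerExp t e y : ℤ) = β + lowerExp t e z ∧
            bitsVal (lowerFrac t e y) (t - 2) < bitsVal (lowerFrac t e z) (t - 2)) ∨
          (β + (lowerExp t e z : ℤ) < β + lowerExp t e y ∨
          β + (lowerExp t e z : ℤ) = β + lowerExp t e y ∧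
            bitsVal (lowerFrac t e z) (t - 2) < bitsVal (lowerFrac t e y) (t - 2)) := by
        omega
      rcases hcases with h | h
      · left
        rw [mul_assoc]
        refine mul_le_mul_of_nonneg_left (le_trans ?_ (mant_gap h).1) hc0.le
        rw [mul_comm]
        gcongr
      · right
        rw [mul_assoc]
        refine mul_le_mul_of_nonneg_left (le_trans (mant_gap h).2 ?_) hc0.le
        rw [mul_comm]
        gcongr
  · have hne : y ≠ z := by rintro rfl; exact hupper ⟨rfl, rfl⟩
    rw [if_neg hne]
    apply hzero
    left
    have hlt := upper_lt_or_of_le (t := t) (e := e) (by omega) (by omega) hmte hyz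
    refine le_trans ?_ (hG.le_run (F := F) (by omega) (by omega) (by omega) (by omega) (by omega)
      (by omega) (by omega))
    have h1 : (2 : ℝ) ^ (-(F.M : ℤ)) ≤ 1 := by
      rw [show (1 : ℝ) = (2 : ℝ) ^ (0 : ℤ) by simp]
      exact zpow_le_zpow_right₀ (by norm_num) (by omega)
    have h2 : D ≤ (2 : ℝ) ^ (β + lowerExp t e y + 1) := by
      have := mant_add_le (β + lowerExp t e y) (lowerFrac t e y) (t - 2)
      have h0 : (0 : ℝ) < (2 : ℝ) ^ (β + (lowerExp t e y : ℤ) - (t - 2 : ℕ)) := by positivity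
      linarith
    calc (2 : ℝ) ^ γ * (1 + (2 : ℝ) ^ (-(F.M : ℤ))) * D
        ≤ (2 : ℝ) ^ γ * (1 + 1) * (2 : ℝ) ^ (β + lowerExp t e y + 1) := by gcongr
      _ = (2 : ℝ) ^ (γ + 1 + (β + lowerExp t e y + 1)) := by
        rw [zpow_add₀ (by norm_num) (γ + 1), zpow_add_one₀ (by norm_num) γ]; norm_num
      -- The worst case has lower exponent `K - 1` and upper exponent `0`, and reduces to `t - 1 ≤
      -- M`.
      _ ≤ (2 : ℝ) ^ (A + upperExp e y - (t - 1 : ℕ)) :=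
        zpow_le_zpow_right₀ (by norm_num) (by omega)

end FPTransformer

open FPTransformer in
theorem theoremC2 (p n m : ℕ) (hp : 6 ≤ p) (hn : 4 * p < n) (hm : m = 2 * p - 1) :
    (∃ t e : ℕ, Admissible m t e) ∧
    ∀ t e : ℕ, Admissible m t e →
      -- at most `p - 1` bits do not suffice, in whatever arithmetic the scores are computed
      (∀ F : Format, F.bits ≤ p - 1 → ∀ (σ : ℝ → ℝ) (d dq dff : ℕ) (hd : 0 < d)
        (T : Transformer (n + 1) (Token e) d dq 1 dff), ¬ ComputesEQ m n t e hd T F σ) ∧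
      -- `p + log p` bits suffice, `t` for the signed mantissa and `e` for the signed exponent
      (∃ F : Format, F.M + 1 = t ∧ F.B + 1 = e ∧ F.bits = p + Nat.clog 2 p ∧
        ∃ (d dq dff : ℕ) (hd : 0 < d) (T : Transformer (n + 1) (Token e) d dq 1 dff),
          ComputesEQ m n t e hd T F id) ∧
      -- `p + log p + 2` bits suffice, where the two sign bits are counted in addition to `t + e`
      (∃ F : Format, F.M = t ∧ F.B = e ∧ F.bits = p + Nat.clog 2 p + 2 ∧
        ∃ (d dq dff : ℕ) (hd : 0 < d) (T : Transformer (n + 1) (Token e) d dq 1 dff),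
          ComputesEQ m n t e hd T F id) := by
  have hmp : (m + 1) / 2 = p := by omega
  have hlg : lg m = Nat.clog 2 p := by rw [lg, hmp]
  -- Three is what the four blocks need to cover `2 * p - 1` bits when `t + e = p + lg m`.
  have hL3 : 3 ≤ lg m := by
    rw [hlg]
    by_contra! h
    have h1 := (Nat.clog_le_iff_le_pow (b := 2) (by norm_num)).mp (show Nat.clog 2 p ≤ 2 by omega)
    omega
  have hpL : p ≤ 2 ^ lg m := by rw [hlg]; exact Nat.le_pow_clog (by norm_num) p
  have hLp : lg m ≤ p := by
    rw [hlg]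
    exact (Nat.clog_le_iff_le_pow (by norm_num)).mpr Nat.lt_two_pow_self.le
  -- The smallest admissible `e`; then `t = p - 3 > 2` is the condition `p ≥ 6`.
  refine ⟨⟨p - 3, lg m + 3, by rw [hmp]; omega, by omega, by omega⟩, ?_⟩
  rintro t e ⟨hte, hLe, ht⟩
  rw [hmp] at hte
  -- The exponent range `2 ^ (e - 1)` is four times `2 ^ (e - 3)`: three parts pay for `3 * M`,
  -- since `p ≤ 2 ^ lg m`, and one for `2 ^ (e - lg m)`. The constants fit because `t ≤ p - 3`.
  have h3 : 2 ^ lg m ≤ 2 ^ (e - 3) := Nat.pow_le_pow_right (by norm_num) (by omega)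
  have hK : 2 ^ (e - lg m) ≤ 2 ^ (e - 3) := Nat.pow_le_pow_right (by norm_num) (by omega)
  have he1 : 2 ^ (e - 1) = 4 * 2 ^ (e - 3) := by
    rw [show e - 1 = e - 3 + 2 by omega, pow_add]; ring
  have he : 2 ^ e = 8 * 2 ^ (e - 3) := by
    conv_lhs => rw [show e = e - 3 + 3 by omega, pow_add]
    ring
  zify at h3 hK he1 he hpL
  refine ⟨fun F hF σ d dq dff hd T => not_computesEQ (by omega) hm (by omega) (by omega)
    (by omega) (by omega) F hF σ hd T, ?_, ?_⟩
  · refine ⟨⟨t - 1, e - 1⟩, by simp only []; omega, by simp only []; omega,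
      by simp only [Format.bits]; omega, 3, 1, 2, by norm_num, _,
      computesEQ_testTransformer ht ?_ (by omega) hLe (by omega) (by omega) (by omega) (by omega)
        ?_ ?_ rfl rfl rfl rfl⟩
    · simp only []; omega
    · simp only [Format.emax]; omega
    · simp only [Format.emax]; omega
  · refine ⟨⟨t, e⟩, rfl, rfl, by simp only [Format.bits]; omega, 3, 1, 2, by norm_num, _,
      computesEQ_testTransformer ht ?_ (by omega) hLe (by omega) (by omega) (by omega) (by omega)
        ?_ ?_ rfl rfl rfl rfl⟩
    · simp only []; omega
    · simp only [Format.emax]; omega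
    · simp only [Format.emax]; omega
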